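/- Let $a(0)=(a_1(0),a_2(0),\dots)$ be a real sequence and consider the system $$\dot a_n(t)=(n-1)a_{n-1}(t)-n\,a_{n+1}(t),\qquad n\ge 1,\ t\ge 0,\qquad a_0(t)=0, \tag{B}$$ with initial values $a_n(0)$. A *solution* means a solution of (B) on $[0,\infty)$ such that for every $T\geq 0$ the generating function $G(z,t)=\sum_{n\ge0}a_{n+1}(t)z^n$ converges in a neighbourhood of $z=0$ uniformly for $t\in[0,T]$, i.e. $|a_n(t)|\le K\gamma^n$ for all $n$ and all $t\in[0,T]$, with constants $K,\gamma$ depending on $T$. Let $A\in\mathbb R$, $A\ne0$, and $\alpha>0$. Consider the two conditions (C) $a_n(0)\sim -\frac{A}{\Gamma(\alpha)}(-1)^n n^{\alpha-1}$ as $n\to\infty$; (D) for some $\eta>0$ and $0<\theta<\pi/2$, $G_0(z)=\sum_{n\ge0}a_{n+1}(0)z^n$ converges near $0$ and extends to a function analytic (at every point) on $\Delta\setminus\{-1\}$, where $\Delta=\{z:|z|\le 1+\eta,\ |\arg(-(z+1))|\ge\theta\}$ with $\arg\in(-\pi,\pi]$, and $G_0(z)\sim A(1+z)^{-\alpha}$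 as $z\to-1$, $z\in\Delta\setminus\{-1\}$ (principal branch). Let $C^\alpha_n$ be the $n$-th Taylor coefficient at $z=0$ of $\frac1{1-z}\left(\frac{1-z}{1+z}\right)^\alpha$, and let $\mathcal E_{0,N}(t)=\sum_{n=0}^N|a_n(t)|^2$ (one-sided time derivative at $t=0$). 1. Assume (C) or (D). Then a solution exists, and every solution satisfies, for each fixed $n\ge1$, $$a_n(t)=e^{(2\alpha-1)t}\left(2^{1-\alpha}A\,C^\alpha_{n-1}+o(1)\right)\quad\text{as }t\to\infty;$$ in particular $a_n(t)\sim 2^{1-\alpha}e^{(2\alpha-1)t}A\,C^\alpha_{n-1}$ whenever $C^\alpha_{n-1}\neq0$. If $\alpha<1/2$, the system is conservative. (Conservative means: either $\sum_n|a_n(t)|^2$ is finite for every $t\geq 0$ and does not depend on $t$, or it is infinite for every $t\ge0$ and $\lim_{N\to\infty}\frac{d}{dt}\mathcal E_{0,N}(t)=0$ for every $t\ge0$.) 2. Assume (D). Then every solution satisfies, for every $t\ge0$, $$a_n(t)\sim\frac{A}{\Gamma(\alpha)}e^{(2\alpha-1)t}(-1)^{n-1}n^{\alpha-1}\quad\text{as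 }n\to\infty .$$ Moreover, for every $t\ge 0$: if $\alpha<1/2$, then $\frac{d}{dt}\mathcal E_{0,N}(t)\to0$ as $N\to\infty$; if $\alpha=1/2$, the energy $\sum_n|a_n(t)|^2$ is infinite and $\frac{d}{dt}\mathcal E_{0,N}(t)$ converges to a finite positive limit as $N\to\infty$ (finite explosion rate); if $\alpha>1/2$, the energy is infinite and $\frac{d}{dt}\mathcal E_{0,N}(t)\to+\infty$ as $N\to\infty$ (infinite explosion rate). -/

import Mathlib

open Filter Topology Asymptotics

namespace ShellModel

/-- `a` solves `ȧ_n = (n-1) a_{n-1} - n a_{n+1}` for `n ≥ 1` and all times `t ≥ 0`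
(one-sided derivative at `t = 0`), with boundary condition `a_0 = 0` and initial values
`a_n(0) = a₀ n` for `n ≥ 1`.  The last field says that the generating function
`G(z,t) = ∑ a_{n+1}(t) z^n` converges near `z = 0`, locally uniformly in time.
Without it the infinite system has nonzero solutions starting from zero. -/
structure IsSolution (a₀ : ℕ → ℝ) (a : ℕ → ℝ → ℝ) : Prop where
  boundary : ∀ t : ℝ, 0 ≤ t → a 0 t = 0
  initial : ∀ m : ℕ, a (m + 1) 0 = a₀ (m + 1)
  ode : ∀ (m : ℕ) (t : ℝ), 0 ≤ t →
    HasDerivWithinAt (a (m + 1)) ((m : ℝ) * a m t - ((m : ℝ) + 1) * a (m + 2) t) (Set.Ici 0) t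
  growth : ∀ T : ℝ, 0 ≤ T → ∃ K γ : ℝ, ∀ t : ℝ, 0 ≤ t → t ≤ T → ∀ n : ℕ, |a n t| ≤ K * γ ^ n

/-- The indented disk `{z : |z| ≤ |ζ| + η, |arg (z - ζ) - arg ζ| ≥ θ}`, the difference of
arguments being taken modulo `2π` in `(-π, π]`. -/
def deltaRegion (ζ : ℂ) (η θ : ℝ) : Set ℂ :=
  {z : ℂ | ‖z‖ ≤ ‖ζ‖ + η ∧ θ ≤ |Complex.arg ((z - ζ) / ζ)|}

/-- `G₀(z) = ∑ a₀(n+1) z^n` extends analytically to an indented disk at `-1` (punctured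
at `-1`), and `G₀(z) ∼ A (z+1)^{-α}` as `z → -1` in it. -/
def HasDeltaSingularity (a₀ : ℕ → ℝ) (A α : ℝ) : Prop :=
  ∃ (G₀ : ℂ → ℂ) (η θ : ℝ), 0 < η ∧ 0 < θ ∧ θ < Real.pi / 2 ∧
    (∀ᶠ z in 𝓝 (0 : ℂ), HasSum (fun n : ℕ => (a₀ (n + 1) : ℂ) * z ^ n) (G₀ z)) ∧
    AnalyticOnNhd ℂ G₀ (deltaRegion (-1) η θ \ {-1}) ∧
    G₀ ~[𝓝[deltaRegion (-1) η θ \ {-1}] (-1)] fun z : ℂ => (A : ℂ) * (z + 1) ^ (-(α : ℂ))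

/-- `a₀(n) ∼ C (-1)^n n^{α-1}` with the constant `C` written as `-A/Γ(α)`. -/
def HasAlternatingPowerLaw (a₀ : ℕ → ℝ) (A α : ℝ) : Prop :=
  a₀ ~[atTop] fun n : ℕ => -(A / Real.Gamma α) * (-1) ^ n * (n : ℝ) ^ (α - 1)

/-- The `n`-th Taylor coefficient at `0` of `(1-z)⁻¹ ((1-z)/(1+z))^α`. -/
noncomputable def taylorC (α : ℝ) (n : ℕ) : ℝ :=
  iteratedDeriv n (fun z : ℝ => 1 / (1 - z) * ((1 - z) / (1 + z)) ^ α) 0 / (n.factorial : ℝ)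

/-- The energy of the modes `M, …, N` at time `t`. -/
noncomputable def blockEnergy (a : ℕ → ℝ → ℝ) (M N : ℕ) (t : ℝ) : ℝ :=
  ∑ n ∈ Finset.Icc M N, |a n t| ^ 2

def FiniteEnergy (a : ℕ → ℝ → ℝ) (t : ℝ) : Prop :=
  Summable fun n : ℕ => |a n t| ^ 2

/-- The derivatives `d/dt E_{0,N}(t)` exist for all `N` and tend to the filter `l` as `N → ∞`. -/
def EnergyRateTendsto (a : ℕ → ℝ → ℝ) (t : ℝ) (l : Filter ℝ) : Prop :=
  ∃ D : ℕ → ℝ, (∀ N : ℕ, HasDerivWithinAt (blockEnergy a 0 N) (D N) (Set.Ici 0) t) ∧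
    Tendsto D atTop l

/-- Conservative: if the energy is finite, it does not change with time; if it is infinite,
`d/dt E_{0,N}(t) → 0` as `N → ∞` at every time. -/
def IsConservative (a : ℕ → ℝ → ℝ) : Prop :=
  (∀ t : ℝ, 0 ≤ t → FiniteEnergy a t ∧ ∑' n : ℕ, |a n t| ^ 2 = ∑' n : ℕ, |a n 0| ^ 2) ∨
  (∀ t : ℝ, 0 ≤ t → ¬ FiniteEnergy a t ∧ EnergyRateTendsto a t (𝓝 0))

/-- The energy is infinite and `d/dt E_{0,N}(t)` has a finite positive limit, at every time. -/
def HasFiniteExplosionRate (a : ℕ → ℝ → ℝ) : Prop :=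
  ∀ t : ℝ, 0 ≤ t → ¬ FiniteEnergy a t ∧ ∃ r : ℝ, 0 < r ∧ EnergyRateTendsto a t (𝓝 r)

/-- The energy is infinite and `d/dt E_{0,N}(t) → +∞`, at every time. -/
def HasInfiniteExplosionRate (a : ℕ → ℝ → ℝ) : Prop :=
  ∀ t : ℝ, 0 ≤ t → ¬ FiniteEnergy a t ∧ EnergyRateTendsto a t atTop

end ShellModel

/-!
The generating function `G(z, t) = ∑ a_{n+1}(t) zⁿ` of a solution obeys the transport equation
`∂ₜ G = (z² - 1) ∂_z G + z G`, which characteristics solve explicitly: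
`G(z, t) = f(φₜ z) / (cosh t - z sinh t)`, where `f = G(·, 0)` and `φₜ` is the one-parameter group
of Möbius automorphisms of the unit disk with fixed points `±1`. Conversely the system determines
`a` within the class of sequences of geometric growth, so every solution is obtained in this way.

Both conditions on the initial values say that `f` is `A (1 + z)^{-α}` up to an error of smaller
order. Since `φₜ` fixes `-1` and multiplies `1 + z` by a nonvanishing analytic function, an error
which is `o((1 + z)^{-α})` at `-1` stays so under the evolution, and the singularity of `G(·, t)`
is `A e^{(2α - 1)t} (1 + z)^{-α}`. Its Taylor coefficients give the power law of `a_n(t)` in `n`.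
For fixed `n`, the points `φₜ z` tend to `-1` as `t → ∞`, and `e^{-(2α - 1)t} G(z, t)` converges to
`2^{1 - α} A (1 - z)^{α - 1} (1 + z)^{-α}`.

The evolution preserves the norm of the Hardy space `H²`, whence conservation of a finite energy:
for `f` analytic across the unit circle the energies of finitely many modes have rates tending to
zero, and the general case follows by dilating `f`, lower semicontinuity and the group property.
In the other cases the energy of the modes up to `N` has rate `-2 N a_N a_{N+1}`, which is of order
`N^{2α - 1}` by the power law.
-/

namespace ShellModel

open Metric

section CircleAverage

theorem continuous_comp_circleMap {E : Type*} [TopologicalSpace E] {f : ℂ → E} {c : ℂ} {R : ℝ}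
    (hf : ContinuousOn f (sphere c |R|)) :
    Continuous fun θ : ℝ => f (circleMap c R θ) :=
  hf.comp_continuous (continuous_circleMap c R) fun θ => circleMap_mem_sphere' c R θ

variable {E : Type*} [NormedAddCommGroup E] [NormedSpace ℝ E] {c : ℂ} {R C : ℝ}

theorem tendsto_circleAverage_of_bounded {ι : Type*} {l : Filter ι} [l.IsCountablyGenerated]
    {F : ι → ℂ → E} {f : ℂ → E} (hF : ∀ i, ContinuousOn (F i) (sphere c |R|))
    (hC : ∀ᶠ i in l, ∀ z ∈ sphere c |R|, ‖F i z‖ ≤ C)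
    (hlim : ∀ z ∈ sphere c |R|, Tendsto (fun i => F i z) l (𝓝 (f z))) :
    Tendsto (fun i => Real.circleAverage (F i) c R) l (𝓝 (Real.circleAverage f c R)) := by
  refine Tendsto.const_smul (intervalIntegral.tendsto_integral_filter_of_dominated_convergence
    (fun _ => C) ?_ ?_ intervalIntegrable_const ?_) _
  · exact .of_forall fun i => (continuous_comp_circleMap (hF i)).aestronglyMeasurable
  · filter_upwards [hC] with i hi
    exact .of_forall fun θ _ => hi _ (circleMap_mem_sphere' c R θ)
  · exact .of_forall fun θ _ => hlim _ (circleMap_mem_sphere' c R θ)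

theorem hasDerivAt_circleAverage {F F' : ℝ → ℂ → E}
    (hF : ∀ t, ContinuousOn (F t) (sphere c |R|))
    (hF' : ContinuousOn (fun p : ℝ × ℂ => F' p.1 p.2) (Set.univ ×ˢ sphere c |R|))
    (hderiv : ∀ t, ∀ z ∈ sphere c |R|, HasDerivAt (fun s => F s z) (F' t z) t) (t : ℝ) :
    HasDerivAt (fun s => Real.circleAverage (F s) c R) (Real.circleAverage (F' t) c R) t := by
  have hmem := circleMap_mem_sphere' c R
  have hK : IsCompact (Set.Icc (t - 1) (t + 1) ×ˢ sphere c |R|) :=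
    isCompact_Icc.prod (isCompact_sphere c |R|)
  obtain ⟨C, hC⟩ := hK.exists_bound_of_continuousOn
    (hF'.mono (Set.prod_mono (Set.subset_univ _) subset_rfl))
  have hF't : ContinuousOn (F' t) (sphere c |R|) :=
    hF'.comp (Continuous.prodMk_right t).continuousOn fun z hz => ⟨trivial, hz⟩
  refine (intervalIntegral.hasDerivAt_integral_of_dominated_loc_of_deriv_le
    (F' := fun s θ => F' s (circleMap c R θ)) (bound := fun _ => C)
    (Icc_mem_nhds (sub_one_lt t) (lt_add_one t)) ?_ ?_ ?_ ?_ intervalIntegrable_const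
    ?_).2.const_smul _
  · exact .of_forall fun s => (continuous_comp_circleMap (hF s)).aestronglyMeasurable
  · exact (continuous_comp_circleMap (hF t)).intervalIntegrable _ _
  · exact (continuous_comp_circleMap hF't).aestronglyMeasurable
  · exact .of_forall fun θ _ s hs => hC (s, _) ⟨hs, hmem θ⟩
  · exact .of_forall fun θ _ s _ => hderiv s _ (hmem θ)

end CircleAverage

section TaylorCoeff

/-- The `n`-th Taylor coefficient of `f` at the origin. -/
noncomputable def taylorCoeff {𝕜 : Type*} [NontriviallyNormedField 𝕜] (f : 𝕜 → 𝕜) (n : ℕ) : 𝕜 :=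
  iteratedDeriv n f 0 / n.factorial

variable {𝕜 : Type*} [RCLike 𝕜] {f g : 𝕜 → 𝕜}

theorem taylorCoeff_eq_of_hasSum {c : ℕ → 𝕜}
    (h : ∀ᶠ z in 𝓝 (0 : 𝕜), HasSum (fun n : ℕ => c n * z ^ n) (f z)) (n : ℕ) :
    taylorCoeff f n = c n := by
  have hp : HasFPowerSeriesAt f (FormalMultilinearSeries.ofScalars 𝕜 c) 0 := by
    rw [hasFPowerSeriesAt_iff]
    filter_upwards [h] with z hz
    simpa [FormalMultilinearSeries.coeff_ofScalars, mul_comm] using hz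
  have hcoeff := congrArg (·.coeff n)
    (hp.analyticAt.hasFPowerSeriesAt.eq_formalMultilinearSeries hp)
  simpa [FormalMultilinearSeries.coeff_ofScalars, taylorCoeff] using hcoeff

theorem eventually_hasSum_taylorCoeff (hf : AnalyticAt 𝕜 f 0) :
    ∀ᶠ z in 𝓝 (0 : 𝕜), HasSum (fun n : ℕ => taylorCoeff f n * z ^ n) (f z) := by
  filter_upwards [hasFPowerSeriesAt_iff.mp hf.hasFPowerSeriesAt] with z hz
  simpa [FormalMultilinearSeries.coeff_ofScalars, taylorCoeff, mul_comm] using hz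

theorem taylorCoeff_congr (h : f =ᶠ[𝓝 0] g) (n : ℕ) : taylorCoeff f n = taylorCoeff g n := by
  rw [taylorCoeff, taylorCoeff, h.iteratedDeriv_eq]

theorem taylorCoeff_zero (f : 𝕜 → 𝕜) : taylorCoeff f 0 = f 0 := by simp [taylorCoeff]

theorem taylorCoeff_add (hf : AnalyticAt 𝕜 f 0) (hg : AnalyticAt 𝕜 g 0) (n : ℕ) :
    taylorCoeff (fun z => f z + g z) n = taylorCoeff f n + taylorCoeff g n := by
  rw [taylorCoeff, iteratedDeriv_fun_add hf.contDiffAt hg.contDiffAt, add_div]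
  rfl

theorem taylorCoeff_sub (hf : AnalyticAt 𝕜 f 0) (hg : AnalyticAt 𝕜 g 0) (n : ℕ) :
    taylorCoeff (fun z => f z - g z) n = taylorCoeff f n - taylorCoeff g n := by
  rw [taylorCoeff, iteratedDeriv_fun_sub hf.contDiffAt hg.contDiffAt, sub_div]
  rfl

theorem taylorCoeff_const_mul (c : 𝕜) (f : 𝕜 → 𝕜) (n : ℕ) :
    taylorCoeff (fun z => c * f z) n = c * taylorCoeff f n := by
  rw [taylorCoeff, iteratedDeriv_const_mul_field, mul_div_assoc, taylorCoeff]

theorem taylorCoeff_comp_const_mul (c : 𝕜) (hf : AnalyticAt 𝕜 f 0) (n : ℕ) :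
    taylorCoeff (fun z => f (c * z)) n = c ^ n * taylorCoeff f n := by
  refine taylorCoeff_eq_of_hasSum (c := fun n => c ^ n * taylorCoeff f n) ?_ n
  have hc : Tendsto (fun z : 𝕜 => c * z) (𝓝 0) (𝓝 0) := by
    simpa using (continuous_const_mul c).tendsto (0 : 𝕜)
  filter_upwards [hc.eventually (eventually_hasSum_taylorCoeff hf)] with z hz
  simpa only [mul_pow, mul_left_comm, mul_assoc] using hz

theorem taylorCoeff_deriv (f : 𝕜 → 𝕜) (n : ℕ) :
    taylorCoeff (deriv f) n = (n + 1) * taylorCoeff f (n + 1) := by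
  have hfac : (n.factorial : 𝕜) ≠ 0 := mod_cast n.factorial_ne_zero
  have hsucc : (n + 1 : 𝕜) ≠ 0 := mod_cast n.succ_ne_zero
  rw [taylorCoeff, taylorCoeff, iteratedDeriv_succ', Nat.factorial_succ]
  push_cast
  field_simp

theorem taylorCoeff_id_mul_succ (hf : AnalyticAt 𝕜 f 0) (n : ℕ) :
    taylorCoeff (fun z => z * f z) (n + 1) = taylorCoeff f n := by
  refine taylorCoeff_eq_of_hasSum (f := fun z => z * f z)
    (c := fun n => if n = 0 then 0 else taylorCoeff f (n - 1)) ?_ (n + 1)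
  filter_upwards [eventually_hasSum_taylorCoeff hf] with z hz
  rw [← hasSum_nat_add_iff' 1]
  simpa [pow_succ', mul_left_comm] using hz.mul_left z

theorem taylorCoeff_generator (hf : AnalyticAt 𝕜 f 0) (n : ℕ) :
    taylorCoeff (fun z => (z ^ 2 - 1) * deriv f z + z * f z) n =
      n * taylorCoeff f (n - 1) - (n + 1) * taylorCoeff f (n + 1) := by
  have hmul (g : 𝕜 → 𝕜) (hg : AnalyticAt 𝕜 g 0) : AnalyticAt 𝕜 (fun z => z * g z) 0 :=
    analyticAt_id.fun_mul hg
  have heq : (fun z => (z ^ 2 - 1) * deriv f z + z * f z) =ᶠ[𝓝 0]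
      fun z => z * deriv (fun w => w * f w) z - deriv f z := by
    filter_upwards [hf.eventually_analyticAt] with z hz
    rw [((hasDerivAt_id' z).fun_mul hz.differentiableAt.hasDerivAt).deriv]
    ring
  rw [taylorCoeff_congr heq, taylorCoeff_sub (hmul _ (hmul f hf).deriv) hf.deriv,
    taylorCoeff_deriv f]
  cases n with
  | zero => simp [taylorCoeff_zero (fun z => z * _)]
  | succ n =>
    rw [taylorCoeff_id_mul_succ (hmul f hf).deriv, taylorCoeff_deriv, taylorCoeff_id_mul_succ hf]
    push_cast
    rfl

end TaylorCoeff

section Cauchy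

variable {f : ℂ → ℂ} {r R : ℝ}

theorem analyticAt_zero_of_differentiableOn_ball (hr : 0 < r)
    (hf : DifferentiableOn ℂ f (ball 0 r)) : AnalyticAt ℂ f 0 :=
  hf.analyticAt (ball_mem_nhds 0 hr)

theorem hasSum_taylorCoeff (hf : DifferentiableOn ℂ f (ball 0 r)) {z : ℂ}
    (hz : z ∈ ball (0 : ℂ) r) : HasSum (fun n : ℕ => taylorCoeff f n * z ^ n) (f z) := by
  lift r to NNReal using (pos_of_mem_ball hz).le
  refine (Complex.hasSum_taylorSeries_on_ball hf hz).congr_fun fun n => ?_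
  simp only [taylorCoeff, sub_zero, smul_eq_mul]
  ring

theorem taylorCoeff_eq_circleAverage (hR : 0 < R) (hf : DiffContOnCl ℂ f (ball 0 R)) (n : ℕ) :
    taylorCoeff f n = Real.circleAverage (fun z => f z / z ^ n) 0 R := by
  have hcauchy := hf.circleIntegral_one_div_sub_center_pow_smul hR n
  have hfac : (n.factorial : ℂ) ≠ 0 := mod_cast n.factorial_ne_zero
  have hintegrand : (fun z : ℂ => (z - 0)⁻¹ • (f z / z ^ n)) =
      fun z => (1 / (z - 0) ^ (n + 1)) • f z := by
    funext z
    simp only [sub_zero, smul_eq_mul, pow_succ, one_div, mul_inv]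
    ring
  rw [Real.circleAverage_eq_circleIntegral hR.ne', hintegrand, hcauchy, taylorCoeff, smul_smul,
    smul_eq_mul]
  field_simp [Complex.two_pi_I_ne_zero]

theorem norm_taylorCoeff_le {C : ℝ} (hR : 0 < R) (hf : DiffContOnCl ℂ f (ball 0 R))
    (hC : ∀ z ∈ sphere (0 : ℂ) R, ‖f z‖ ≤ C) (n : ℕ) : ‖taylorCoeff f n‖ ≤ C / R ^ n := by
  have hfac : (0 : ℝ) < n.factorial := mod_cast n.factorial_pos
  rw [taylorCoeff, norm_div, Complex.norm_natCast, div_le_iff₀ hfac]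
  refine (Complex.norm_iteratedDeriv_le_of_forall_mem_sphere_norm_le n hR hf hC).trans_eq ?_
  ring

theorem exists_norm_taylorCoeff_le_of_isCompact {X : Type*} [TopologicalSpace X] {K : Set X}
    {F : X → ℂ → ℂ} (hK : IsCompact K) (hR : 0 < R)
    (hF : ∀ x ∈ K, DiffContOnCl ℂ (F x) (ball 0 R))
    (hcont : ContinuousOn (fun p : X × ℂ => F p.1 p.2) (K ×ˢ sphere 0 R)) :
    ∃ C : ℝ, ∀ x ∈ K, ∀ n : ℕ, ‖taylorCoeff (F x) n‖ ≤ C / R ^ n := by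
  obtain ⟨C, hC⟩ := (hK.prod (isCompact_sphere 0 R)).exists_bound_of_continuousOn hcont
  exact ⟨C, fun x hx => norm_taylorCoeff_le hR (hF x hx) fun z hz => hC (x, z) ⟨hx, hz⟩⟩

theorem continuousOn_sphere_div_pow (hR : 0 < R) (hf : DiffContOnCl ℂ f (ball 0 R)) (n : ℕ) :
    ContinuousOn (fun z => f z / z ^ n) (sphere 0 |R|) := by
  rw [abs_of_pos hR]
  refine (hf.continuousOn.mono ?_).div (by fun_prop) fun z hz =>
    pow_ne_zero n (ne_of_mem_sphere hz hR.ne')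
  rw [closure_ball 0 hR.ne']
  exact sphere_subset_closedBall

theorem tendsto_taylorCoeff_of_bounded {ι : Type*} {l : Filter ι} [l.IsCountablyGenerated]
    {F : ι → ℂ → ℂ} {C : ℝ} (hR : 0 < R) (hF : ∀ i, DiffContOnCl ℂ (F i) (ball 0 R))
    (hf : DiffContOnCl ℂ f (ball 0 R))
    (hC : ∀ᶠ i in l, ∀ z ∈ sphere (0 : ℂ) R, ‖F i z‖ ≤ C)
    (hlim : ∀ z ∈ sphere (0 : ℂ) R, Tendsto (fun i => F i z) l (𝓝 (f z))) (n : ℕ) :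
    Tendsto (fun i => taylorCoeff (F i) n) l (𝓝 (taylorCoeff f n)) := by
  simp only [taylorCoeff_eq_circleAverage hR, hF, hf]
  rw [← abs_of_pos hR] at hC hlim
  refine tendsto_circleAverage_of_bounded (C := C / |R| ^ n)
    (fun i => continuousOn_sphere_div_pow hR (hF i) n) ?_ fun z hz => (hlim z hz).div_const _
  filter_upwards [hC] with i hi z hz
  rw [norm_div, norm_pow, mem_sphere_zero_iff_norm.mp hz]
  gcongr
  exact hi z hz

theorem hasDerivAt_taylorCoeff {F F' : ℝ → ℂ → ℂ} (hR : 0 < R)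
    (hF : ∀ t, DiffContOnCl ℂ (F t) (ball 0 R)) (hF' : ∀ t, DiffContOnCl ℂ (F' t) (ball 0 R))
    (hcont : ContinuousOn (fun p : ℝ × ℂ => F' p.1 p.2) (Set.univ ×ˢ sphere 0 R))
    (hderiv : ∀ t, ∀ z ∈ sphere (0 : ℂ) R, HasDerivAt (fun s => F s z) (F' t z) t)
    (n : ℕ) (t : ℝ) :
    HasDerivAt (fun s => taylorCoeff (F s) n) (taylorCoeff (F' t) n) t := by
  simp only [taylorCoeff_eq_circleAverage hR, hF, hF']
  rw [← abs_of_pos hR] at hcont hderiv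
  refine hasDerivAt_circleAverage (fun s => continuousOn_sphere_div_pow hR (hF s) n) ?_
    (fun s z hz => (hderiv s z hz).div_const _) t
  exact hcont.div (by fun_prop) fun p hp =>
    pow_ne_zero n (ne_of_mem_sphere hp.2 (abs_ne_zero.mpr hR.ne'))

end Cauchy

section ShellSystem

variable {E : Type*} [NormedAddCommGroup E]

/-- `u` solves `u_n' = n u_{n-1} - (n+1) u_{n+1}`, `n ≥ 0`, on the time set `s`. This is the system
for `u n = a (n + 1)`, where the boundary condition is taken care of by the factor `n`. -/
def SolvesShellSystem [NormedSpace ℝ E] (u : ℕ → ℝ → E) (s : Set ℝ) : Prop :=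
  ∀ n : ℕ, ∀ t ∈ s,
    HasDerivWithinAt (u n) ((n : ℝ) • u (n - 1) t - ((n : ℝ) + 1) • u (n + 1) t) s t

/-- The growth condition `‖u n t‖ ≤ K γ^n`, uniform in `t ∈ s`, that singles out the solution whose
generating function converges near the origin. -/
def HasGeometricBound (u : ℕ → ℝ → E) (s : Set ℝ) : Prop :=
  ∃ K γ : ℝ, ∀ t ∈ s, ∀ n, ‖u n t‖ ≤ K * γ ^ n

section GeometricBound

variable {u v : ℕ → ℝ → E} {s : Set ℝ}

theorem HasGeometricBound.exists_one_le (hu : HasGeometricBound u s) :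
    ∃ K γ : ℝ, 0 ≤ K ∧ 1 ≤ γ ∧ ∀ t ∈ s, ∀ n, ‖u n t‖ ≤ K * γ ^ n := by
  obtain ⟨K, γ, hK⟩ := hu
  refine ⟨|K|, |γ| + 1, abs_nonneg K, by simp, fun t ht n => (hK t ht n).trans ?_⟩
  calc K * γ ^ n ≤ |K| * |γ| ^ n := by rw [← abs_pow, ← abs_mul]; exact le_abs_self _
    _ ≤ |K| * (|γ| + 1) ^ n := by gcongr; exact le_add_of_nonneg_right zero_le_one

theorem HasGeometricBound.exists_norm_sub_le (hu : HasGeometricBound u s)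
    (hv : HasGeometricBound v s) :
    ∃ K γ : ℝ, 1 ≤ γ ∧ ∀ t ∈ s, ∀ n, ‖u n t - v n t‖ ≤ K * γ ^ n := by
  obtain ⟨K, γ, hK, hγ, hbound⟩ := hu.exists_one_le
  obtain ⟨K', γ', hK', hγ', hbound'⟩ := hv.exists_one_le
  refine ⟨K + K', max γ γ', hγ.trans (le_max_left _ _), fun t ht n => ?_⟩
  calc ‖u n t - v n t‖ ≤ K * γ ^ n + K' * γ' ^ n :=
        (norm_sub_le _ _).trans (add_le_add (hbound t ht n) (hbound' t ht n))
    _ ≤ K * max γ γ' ^ n + K' * max γ γ' ^ n := by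
        gcongr
        exacts [le_max_left _ _, le_max_right _ _]
    _ = (K + K') * max γ γ' ^ n := (add_mul _ _ _).symm

end GeometricBound

section Uniqueness

variable [NormedSpace ℝ E] {u v : ℕ → ℝ → E} {s s' : Set ℝ} {K γ a b t : ℝ}

theorem SolvesShellSystem.mono (hu : SolvesShellSystem u s) (hs : s' ⊆ s) :
    SolvesShellSystem u s' := fun n t ht => (hu n t (hs ht)).mono hs

theorem SolvesShellSystem.sub (hu : SolvesShellSystem u s) (hv : SolvesShellSystem v s) :
    SolvesShellSystem (fun n t => u n t - v n t) s := fun n t ht =>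
  ((hu n t ht).fun_sub (hv n t ht)).congr_deriv (by module)

theorem SolvesShellSystem.continuousOn (hu : SolvesShellSystem u s) (n : ℕ) :
    ContinuousOn (u n) s := fun t ht => (hu n t ht).continuousWithinAt

theorem norm_shellSystem_rhs_le {x y : E} {M : ℝ} (n : ℕ) (hx : ‖x‖ ≤ M) (hy : ‖y‖ ≤ M) :
    ‖(n : ℝ) • x - ((n : ℝ) + 1) • y‖ ≤ 2 * (n + 1) * M := by
  have hn : (0 : ℝ) ≤ n + 1 := by positivity
  calc ‖(n : ℝ) • x - ((n : ℝ) + 1) • y‖ ≤ n * ‖x‖ + (n + 1) * ‖y‖ := by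
        refine (norm_sub_le _ _).trans_eq ?_
        rw [norm_smul, norm_smul, Real.norm_natCast, Real.norm_of_nonneg hn]
    _ ≤ n * M + (n + 1) * M := by gcongr
    _ ≤ 2 * (n + 1) * M := by linarith [(norm_nonneg x).trans hx]

theorem SolvesShellSystem.norm_le_of_neighbours_le {n k : ℕ} {M : ℝ}
    (hu : SolvesShellSystem u (Set.Icc a b)) (ha : u n a = 0)
    (hprev : ∀ x ∈ Set.Icc a b, ‖u (n - 1) x‖ ≤ M * (x - a) ^ k)
    (hnext : ∀ x ∈ Set.Icc a b, ‖u (n + 1) x‖ ≤ M * (x - a) ^ k) (ht : t ∈ Set.Icc a b) :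
    ‖u n t‖ ≤ 2 * (n + 1) * M / (k + 1) * (t - a) ^ (k + 1) := by
  have hprimitive (x : ℝ) : HasDerivAt
      (fun x => 2 * (n + 1) * M / (k + 1) * (x - a) ^ (k + 1))
      (2 * (n + 1) * (M * (x - a) ^ k)) x := by
    refine ((((hasDerivAt_id' x).sub_const a).fun_pow (k + 1)).const_mul _).congr_deriv ?_
    push_cast
    field_simp
  refine image_norm_le_of_norm_deriv_right_le_deriv_boundary (hu.continuousOn n)
    (fun x hx => (hu n x (Set.Ico_subset_Icc_self hx)).mono_of_mem_nhdsWithin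
      (Icc_mem_nhdsGE_of_mem hx)) (by simp [ha]) hprimitive (fun x hx => ?_) ht
  have hmem := Set.Ico_subset_Icc_self hx
  exact norm_shellSystem_rhs_le n (hprev x hmem) (hnext x hmem)

/-- Integrating the system `k` times gains the factor `(2 (t - a))^k / k!`, against which the
product `(n+1) ⋯ (n+k)` of the coefficients is only exponential. -/
theorem SolvesShellSystem.norm_le_of_eq_zero (hu : SolvesShellSystem u (Set.Icc a b))
    (ha : ∀ n, u n a = 0) (hγ : 1 ≤ γ) (hbound : ∀ t ∈ Set.Icc a b, ∀ n, ‖u n t‖ ≤ K * γ ^ n)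
    (k : ℕ) : ∀ t ∈ Set.Icc a b, ∀ n,
      ‖u n t‖ ≤ K * γ ^ (n + k) * 2 ^ k * (n + k).choose k * (t - a) ^ k := by
  induction k with
  | zero => intro t ht n; simpa using hbound t ht n
  | succ k ih =>
    intro t ht n
    have hK : 0 ≤ K := by simpa using (norm_nonneg _).trans (hbound t ht 0)
    have hprev (x : ℝ) (hx : x ∈ Set.Icc a b) : ‖u (n - 1) x‖ ≤
        K * γ ^ (n + 1 + k) * 2 ^ k * (n + 1 + k).choose k * (x - a) ^ k := by
      have hxa : 0 ≤ x - a := sub_nonneg.mpr hx.1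
      have hchoose : (n - 1 + k).choose k ≤ (n + 1 + k).choose k :=
        Nat.choose_le_choose k (by omega)
      refine (ih x hx (n - 1)).trans ?_
      gcongr
      omega
    have hchoose : ((n + 1 + k).choose (k + 1) : ℝ) * (k + 1) =
        (n + 1 + k).choose k * (n + 1) := by
      exact_mod_cast (Nat.choose_succ_right_eq (n + 1 + k) k).trans
        (by rw [Nat.add_sub_cancel])
    refine (hu.norm_le_of_neighbours_le (ha n) hprev (fun x hx => ih x hx (n + 1)) ht).trans_eq ?_
    rw [show n + (k + 1) = n + 1 + k by ring, pow_succ 2 k]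
    rw [div_mul_eq_mul_div, div_eq_iff (by positivity)]
    linear_combination -(K * γ ^ (n + 1 + k) * (2 ^ k * 2) * (t - a) ^ (k + 1)) * hchoose

theorem SolvesShellSystem.eq_zero_of_short (hu : SolvesShellSystem u (Set.Icc a b))
    (ha : ∀ n, u n a = 0) (hγ : 1 ≤ γ) (hbound : ∀ t ∈ Set.Icc a b, ∀ n, ‖u n t‖ ≤ K * γ ^ n)
    (ht : t ∈ Set.Icc a b) (hshort : 4 * γ * (t - a) < 1) (n : ℕ) : u n t = 0 := by
  have hta : 0 ≤ t - a := sub_nonneg.mpr ht.1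
  have hK : 0 ≤ K := by simpa using (norm_nonneg _).trans (hbound t ht 0)
  have hle (k : ℕ) : ‖u n t‖ ≤ K * γ ^ n * 2 ^ n * (4 * γ * (t - a)) ^ k :=
    calc ‖u n t‖ ≤ K * γ ^ (n + k) * 2 ^ k * (n + k).choose k * (t - a) ^ k :=
          hu.norm_le_of_eq_zero ha hγ hbound k t ht n
      _ ≤ K * γ ^ (n + k) * 2 ^ k * 2 ^ (n + k) * (t - a) ^ k := by
          gcongr
          exact_mod_cast Nat.choose_le_two_pow (n + k) k
      _ = K * γ ^ n * 2 ^ n * (4 * γ * (t - a)) ^ k := by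
          rw [mul_pow, mul_pow, show (4 : ℝ) = 2 * 2 by norm_num, mul_pow, pow_add, pow_add]
          ring
  have hlim : Tendsto (fun k : ℕ => K * γ ^ n * 2 ^ n * (4 * γ * (t - a)) ^ k) atTop (𝓝 0) := by
    simpa using (tendsto_pow_atTop_nhds_zero_of_lt_one (by positivity) hshort).const_mul
      (K * γ ^ n * 2 ^ n)
  exact norm_le_zero_iff.mp (ge_of_tendsto' hlim hle)

theorem SolvesShellSystem.eq_zero (hu : SolvesShellSystem u (Set.Icc a b))
    (ha : ∀ n, u n a = 0) (hγ : 1 ≤ γ) (hbound : ∀ t ∈ Set.Icc a b, ∀ n, ‖u n t‖ ≤ K * γ ^ n)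
    (ht : t ∈ Set.Icc a b) (n : ℕ) : u n t = 0 := by
  suffices Set.Icc a b ⊆ {t | ∀ n, u n t = 0} from this ht n
  refine IsClosed.Icc_subset_of_forall_mem_nhdsWithin ?_ ha fun x ⟨hx, hxab⟩ => ?_
  · have hclosed : IsClosed (⋂ n, Set.Icc a b ∩ u n ⁻¹' {0}) := isClosed_iInter fun n =>
      (hu.continuousOn n).preimage_isClosed_of_isClosed isClosed_Icc isClosed_singleton
    rw [← Set.inter_iInter, Set.inter_comm] at hclosed
    convert hclosed
    ext t
    simp
  · have hstep : x < x + 1 / (8 * γ) := lt_add_of_pos_right x (by positivity)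
    filter_upwards [Icc_mem_nhdsGT (lt_min hxab.2 hstep)] with y hy n
    have hsub : Set.Icc x b ⊆ Set.Icc a b := Set.Icc_subset_Icc_left hxab.1
    refine (hu.mono hsub).eq_zero_of_short hx hγ (fun t ht => hbound t (hsub ht))
      ⟨hy.1, hy.2.trans (min_le_left _ _)⟩ ?_ n
    have hyx : y - x ≤ 1 / (8 * γ) := by linarith [hy.2.trans (min_le_right _ _)]
    calc 4 * γ * (y - x) ≤ 4 * γ * (1 / (8 * γ)) := by gcongr
      _ = 1 / 2 := by field_simp; norm_num
      _ < 1 := by norm_num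

theorem SolvesShellSystem.unique (hu : SolvesShellSystem u (Set.Icc a b))
    (hv : SolvesShellSystem v (Set.Icc a b)) (hu' : HasGeometricBound u (Set.Icc a b))
    (hv' : HasGeometricBound v (Set.Icc a b)) (ha : ∀ n, u n a = v n a) (ht : t ∈ Set.Icc a b)
    (n : ℕ) : u n t = v n t := by
  obtain ⟨K, γ, hγ, hbound⟩ := hu'.exists_norm_sub_le hv'
  exact sub_eq_zero.mp ((hu.sub hv).eq_zero (fun n => sub_eq_zero.mpr (ha n)) hγ hbound ht n)

end Uniqueness

theorem SolvesShellSystem.hasDerivWithinAt_energy [InnerProductSpace ℝ E] {u : ℕ → ℝ → E}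
    {s : Set ℝ} {t : ℝ} (hu : SolvesShellSystem u s) (ht : t ∈ s) (N : ℕ) :
    HasDerivWithinAt (fun x => ∑ n ∈ Finset.range N, ‖u n x‖ ^ 2)
      (-2 * N * inner ℝ (u (N - 1) t) (u N t)) s t := by
  refine (HasDerivWithinAt.fun_sum fun n _ => (hu n t ht).norm_sq).congr_deriv ?_
  induction N with
  | zero => simp
  | succ N ih =>
    rw [Finset.sum_range_succ, ih, inner_sub_right, real_inner_smul_right, real_inner_smul_right,
      real_inner_comm (u (N - 1) t), Nat.add_sub_cancel]
    push_cast
    ring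

end ShellSystem

section Flow

/-- The denominator of the Möbius map `flow t`. -/
noncomputable def flowDen (t : ℝ) (z : ℂ) : ℂ := Real.cosh t - z * Real.sinh t

/-- The one-parameter group `z ↦ (z cosh t - sinh t) / (cosh t - z sinh t)` of automorphisms of
the unit disk, that is the flow of the vector field `w² - 1`. -/
noncomputable def flow (t : ℝ) (z : ℂ) : ℂ := (z * Real.cosh t - Real.sinh t) / flowDen t z

variable {s t : ℝ} {z : ℂ}

theorem flowDen_zero (z : ℂ) : flowDen 0 z = 1 := by simp [flowDen]

theorem flow_zero (z : ℂ) : flow 0 z = z := by simp [flow, flowDen_zero]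

theorem flowDen_neg_one (t : ℝ) : flowDen t (-1) = (Real.exp t : ℝ) := by
  rw [flowDen, ← Real.cosh_add_sinh]
  push_cast
  ring

theorem flow_mul_flowDen (hz : flowDen t z ≠ 0) :
    flow t z * flowDen t z = z * Real.cosh t - Real.sinh t :=
  div_mul_cancel₀ _ hz

theorem flowDen_add (hz : flowDen t z ≠ 0) :
    flowDen (s + t) z = flowDen s (flow t z) * flowDen t z := by
  rw [flowDen, flowDen, sub_mul, mul_right_comm, flow_mul_flowDen hz, flowDen, Real.cosh_add,
    Real.sinh_add]
  push_cast
  ring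

theorem flow_add (hz : flowDen t z ≠ 0) : flow (s + t) z = flow s (flow t z) := by
  have hnum : z * Real.cosh (s + t) - Real.sinh (s + t) =
      (flow t z * Real.cosh s - Real.sinh s) * flowDen t z := by
    rw [sub_mul, mul_right_comm, flow_mul_flowDen hz, flowDen, Real.cosh_add, Real.sinh_add]
    push_cast
    ring
  rw [flow, flow, flowDen_add hz, hnum, mul_div_mul_right _ _ hz]

theorem re_flowDen_pos (t : ℝ) (hz : ‖z‖ ≤ 1) : 0 < (flowDen t z).re := by
  have hre := abs_le.mp ((Complex.abs_re_le_norm z).trans hz)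
  have hsinh := Real.sinh_lt_cosh t
  have hsinh' := Real.sinh_lt_cosh (-t)
  rw [Real.sinh_neg, Real.cosh_neg] at hsinh'
  simp only [flowDen, Complex.sub_re, Complex.re_mul_ofReal, Complex.ofReal_re]
  cases le_total 0 (Real.sinh t) <;> nlinarith

theorem flowDen_ne_zero (t : ℝ) (hz : ‖z‖ ≤ 1) : flowDen t z ≠ 0 := fun h =>
  (re_flowDen_pos t hz).ne' (by rw [h, Complex.zero_re])

theorem norm_flowDen_sq_sub (t : ℝ) (z : ℂ) :
    ‖flowDen t z‖ ^ 2 - ‖z * Real.cosh t - Real.sinh t‖ ^ 2 = 1 - ‖z‖ ^ 2 := by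
  simp only [← Complex.normSq_eq_norm_sq, Complex.normSq_apply, flowDen, Complex.sub_re,
    Complex.sub_im, Complex.mul_re, Complex.mul_im, Complex.ofReal_re, Complex.ofReal_im]
  linear_combination (1 - z.re ^ 2 - z.im ^ 2) * Real.cosh_sq t

theorem one_sub_norm_flow_sq (hz : flowDen t z ≠ 0) :
    1 - ‖flow t z‖ ^ 2 = (1 - ‖z‖ ^ 2) / ‖flowDen t z‖ ^ 2 := by
  have hnorm : ‖flowDen t z‖ ≠ 0 := norm_ne_zero_iff.mpr hz
  rw [← norm_flowDen_sq_sub t z, flow, norm_div]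
  field_simp

theorem norm_flow_lt_one (t : ℝ) (hz : ‖z‖ < 1) : ‖flow t z‖ < 1 := by
  have hpos : 0 < 1 - ‖flow t z‖ ^ 2 := by
    have hden := flowDen_ne_zero t hz.le
    rw [one_sub_norm_flow_sq hden]
    exact div_pos (by nlinarith [norm_nonneg z]) (by positivity)
  nlinarith [norm_nonneg (flow t z)]

theorem norm_flow_le_one (t : ℝ) (hz : ‖z‖ ≤ 1) : ‖flow t z‖ ≤ 1 := by
  have hnonneg : 0 ≤ 1 - ‖flow t z‖ ^ 2 := by
    rw [one_sub_norm_flow_sq (flowDen_ne_zero t hz)]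
    exact div_nonneg (by nlinarith [norm_nonneg z]) (by positivity)
  nlinarith [norm_nonneg (flow t z)]

theorem mapsTo_flow_ball (t : ℝ) : Set.MapsTo (flow t) (ball 0 1) (ball 0 1) := fun _ hz =>
  mem_ball_zero_iff.mpr (norm_flow_lt_one t (mem_ball_zero_iff.mp hz))

theorem one_add_flow (hz : flowDen t z ≠ 0) :
    1 + flow t z = Real.exp (-t) * (1 + z) / flowDen t z := by
  rw [eq_div_iff hz, add_mul, flow_mul_flowDen hz, ← Real.cosh_sub_sinh, flowDen]
  push_cast
  ring

theorem cosh_sq_sub_sinh_sq_ofReal (t : ℝ) :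
    (Real.cosh t : ℂ) ^ 2 - (Real.sinh t : ℂ) ^ 2 = 1 := mod_cast Real.cosh_sq_sub_sinh_sq t

theorem hasDerivAt_flowDen (t : ℝ) (z : ℂ) : HasDerivAt (flowDen t) (-(Real.sinh t : ℂ)) z := by
  refine (((hasDerivAt_id' z).mul_const (Real.sinh t : ℂ)).const_sub
    (Real.cosh t : ℂ)).congr_deriv ?_
  rw [one_mul]

theorem differentiable_flowDen (t : ℝ) : Differentiable ℂ (flowDen t) := fun z =>
  (hasDerivAt_flowDen t z).differentiableAt

theorem hasDerivAt_flow (hz : flowDen t z ≠ 0) : HasDerivAt (flow t) (1 / flowDen t z ^ 2) z := by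
  have hnum : HasDerivAt (fun w : ℂ => w * (Real.cosh t : ℂ) - Real.sinh t)
      (Real.cosh t : ℂ) z := by
    simpa using ((hasDerivAt_id' z).mul_const (Real.cosh t : ℂ)).sub_const (Real.sinh t : ℂ)
  refine (hnum.div (hasDerivAt_flowDen t z) hz).congr_deriv ?_
  rw [div_left_inj' (pow_ne_zero 2 hz), flowDen]
  linear_combination cosh_sq_sub_sinh_sq_ofReal t

theorem hasDerivAt_flowDen_time (hz : flowDen t z ≠ 0) :
    HasDerivAt (fun s => flowDen s z) (-(flow t z * flowDen t z)) t := by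
  refine ((Real.hasDerivAt_cosh t).ofReal_comp.sub
    ((Real.hasDerivAt_sinh t).ofReal_comp.const_mul z)).congr_deriv ?_
  rw [flow_mul_flowDen hz, neg_sub]

theorem hasDerivAt_flow_time (hz : flowDen t z ≠ 0) :
    HasDerivAt (fun s => flow s z) (flow t z ^ 2 - 1) t := by
  have hnum : HasDerivAt (fun s : ℝ => z * (Real.cosh s : ℂ) - Real.sinh s) (-flowDen t z) t := by
    rw [flowDen, neg_sub]
    exact ((Real.hasDerivAt_cosh t).ofReal_comp.const_mul z).sub
      (Real.hasDerivAt_sinh t).ofReal_comp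
  refine (hnum.div (hasDerivAt_flowDen_time hz) hz).congr_deriv ?_
  rw [← flow_mul_flowDen hz]
  field_simp
  ring

theorem continuous_flowDen : Continuous fun p : ℝ × ℂ => flowDen p.1 p.2 := by
  unfold flowDen
  fun_prop

theorem continuousOn_flow :
    ContinuousOn (fun p : ℝ × ℂ => flow p.1 p.2) {p | flowDen p.1 p.2 ≠ 0} :=
  ContinuousOn.div (by fun_prop) continuous_flowDen.continuousOn fun _ hp => hp

end Flow

section Evolve

/-- The generating function at time `t` of the solution whose generating function at time `0` is
`f`: the transport of `f` along the characteristics `flow`. -/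
noncomputable def evolve (f : ℂ → ℂ) (t : ℝ) (z : ℂ) : ℂ := f (flow t z) / flowDen t z

variable {f : ℂ → ℂ} {s t : ℝ} {z : ℂ}

theorem evolve_zero (f : ℂ → ℂ) : evolve f 0 = f := by
  funext z
  rw [evolve, flow_zero, flowDen_zero, div_one]

theorem evolve_evolve (f : ℂ → ℂ) (hz : flowDen t z ≠ 0) :
    evolve (evolve f s) t z = evolve f (s + t) z := by
  rw [evolve, evolve, evolve, flow_add hz, flowDen_add hz, div_div]

theorem hasDerivAt_evolve (hz : flowDen t z ≠ 0) (hf : DifferentiableAt ℂ f (flow t z)) :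
    HasDerivAt (evolve f t)
      (evolve (deriv f) t z / flowDen t z ^ 2 + Real.sinh t * evolve f t z / flowDen t z) z := by
  refine ((hf.hasDerivAt.comp z (hasDerivAt_flow hz)).div
    (hasDerivAt_flowDen t z) hz).congr_deriv ?_
  simp only [Function.comp_apply, evolve]
  field_simp
  ring

theorem hasDerivAt_evolve_time (hz : flowDen t z ≠ 0) (hf : DifferentiableAt ℂ f (flow t z)) :
    HasDerivAt (fun s => evolve f s z)
      ((z ^ 2 - 1) * deriv (evolve f t) z + z * evolve f t z) t := by
  refine ((hf.hasDerivAt.comp t (hasDerivAt_flow_time hz)).div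
    (hasDerivAt_flowDen_time hz) hz).congr_deriv ?_
  have hfield : (flow t z ^ 2 - 1) * flowDen t z ^ 2 = z ^ 2 - 1 := by
    rw [sub_mul, ← mul_pow, flow_mul_flowDen hz, flowDen]
    linear_combination (z ^ 2 - 1) * cosh_sq_sub_sinh_sq_ofReal t
  have hden : flow t z * flowDen t z = (z ^ 2 - 1) * Real.sinh t + z * flowDen t z := by
    rw [flow_mul_flowDen hz, flowDen]
    ring
  rw [(hasDerivAt_evolve hz hf).deriv]
  simp only [Function.comp_apply, evolve]
  field_simp
  linear_combination deriv f (flow t z) * hfield + flowDen t z * f (flow t z) * hden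

theorem continuousOn_evolve {S : Set (ℝ × ℂ)} {U : Set ℂ} (hf : ContinuousOn f U)
    (hS : ∀ p ∈ S, flowDen p.1 p.2 ≠ 0) (hmaps : ∀ p ∈ S, flow p.1 p.2 ∈ U) :
    ContinuousOn (fun p : ℝ × ℂ => evolve f p.1 p.2) S :=
  (hf.comp (continuousOn_flow.mono hS) hmaps).div continuous_flowDen.continuousOn hS

theorem differentiableOn_evolve {S U : Set ℂ} (hf : DifferentiableOn ℂ f U)
    (hS : ∀ w ∈ S, flowDen t w ≠ 0) (hmaps : Set.MapsTo (flow t) S U) :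
    DifferentiableOn ℂ (evolve f t) S :=
  (hf.comp (fun w hw => (hasDerivAt_flow (hS w hw)).differentiableAt.differentiableWithinAt)
    hmaps).div (differentiable_flowDen t).differentiableOn hS

theorem continuousOn_evolve_ball (hf : ContinuousOn f (ball 0 1)) :
    ContinuousOn (fun p : ℝ × ℂ => evolve f p.1 p.2) (Set.univ ×ˢ ball 0 1) :=
  continuousOn_evolve hf (fun p hp => flowDen_ne_zero p.1 (mem_ball_zero_iff.mp hp.2).le)
    fun p hp => mapsTo_flow_ball p.1 hp.2

theorem differentiableOn_evolve_ball (hf : DifferentiableOn ℂ f (ball 0 1)) (t : ℝ) :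
    DifferentiableOn ℂ (evolve f t) (ball 0 1) :=
  differentiableOn_evolve hf (fun _ hw => flowDen_ne_zero t (mem_ball_zero_iff.mp hw).le)
    (mapsTo_flow_ball t)

theorem continuousOn_deriv_evolve (hf : DifferentiableOn ℂ f (ball 0 1)) :
    ContinuousOn (fun p : ℝ × ℂ => deriv (evolve f p.1) p.2) (Set.univ ×ˢ ball 0 1) := by
  have hden : ∀ p ∈ (Set.univ : Set ℝ) ×ˢ ball (0 : ℂ) 1, flowDen p.1 p.2 ≠ 0 := fun p hp =>
    flowDen_ne_zero p.1 (mem_ball_zero_iff.mp hp.2).le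
  refine ContinuousOn.congr (f := fun p : ℝ × ℂ => evolve (deriv f) p.1 p.2 /
    flowDen p.1 p.2 ^ 2 + Real.sinh p.1 * evolve f p.1 p.2 / flowDen p.1 p.2) ?_ fun p hp =>
    (hasDerivAt_evolve (hden p hp)
      (hf.differentiableAt (isOpen_ball.mem_nhds (mapsTo_flow_ball p.1 hp.2)))).deriv
  have hflowDen := continuous_flowDen.continuousOn (s := (Set.univ : Set ℝ) ×ˢ ball (0 : ℂ) 1)
  have hsinh : Continuous fun p : ℝ × ℂ => (Real.sinh p.1 : ℂ) := by fun_prop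
  exact ((continuousOn_evolve_ball (hf.deriv isOpen_ball).continuousOn).div (hflowDen.pow 2)
    fun p hp => pow_ne_zero 2 (hden p hp)).add
      ((hsinh.continuousOn.mul (continuousOn_evolve_ball hf.continuousOn)).div hflowDen hden)

theorem hasDerivAt_taylorCoeff_evolve (hf : DifferentiableOn ℂ f (ball 0 1)) (n : ℕ) (t : ℝ) :
    HasDerivAt (fun s => taylorCoeff (evolve f s) n)
      (n * taylorCoeff (evolve f t) (n - 1) - (n + 1) * taylorCoeff (evolve f t) (n + 1)) t := by
  have hevolve := differentiableOn_evolve_ball hf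
  have hsub : closedBall (0 : ℂ) (1 / 2) ⊆ ball 0 1 := closedBall_subset_ball (by norm_num)
  have hsub' : sphere (0 : ℂ) (1 / 2) ⊆ ball 0 1 := sphere_subset_closedBall.trans hsub
  rw [← taylorCoeff_generator ((hevolve t).analyticAt (ball_mem_nhds 0 one_pos))]
  refine hasDerivAt_taylorCoeff (R := 1 / 2) (by norm_num)
    (F' := fun t z => (z ^ 2 - 1) * deriv (evolve f t) z + z * evolve f t z)
    (fun t => (hevolve t).diffContOnCl_ball hsub) (fun t => ?_) ?_ (fun t z hz => ?_) n t
  · exact DifferentiableOn.diffContOnCl_ball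
      (((differentiableOn_id.pow 2).sub_const 1 |>.mul ((hevolve t).deriv isOpen_ball)).add
        (differentiableOn_id.mul (hevolve t))) hsub
  · refine ContinuousOn.mono ?_ (Set.prod_mono subset_rfl hsub')
    exact (ContinuousOn.mul (by fun_prop) (continuousOn_deriv_evolve hf)).add
      (ContinuousOn.mul (by fun_prop) (continuousOn_evolve_ball hf.continuousOn))
  · exact hasDerivAt_evolve_time (flowDen_ne_zero t (mem_ball_zero_iff.mp (hsub' hz)).le)
      (hf.differentiableAt (isOpen_ball.mem_nhds (mapsTo_flow_ball t (hsub' hz))))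

end Evolve

section ShellSolution

/-- `f` is holomorphic in the unit disk with Taylor series `∑ a₀(n+1) zⁿ`. -/
structure IsGenerating (a₀ : ℕ → ℝ) (f : ℂ → ℂ) : Prop where
  differentiableOn : DifferentiableOn ℂ f (ball 0 1)
  taylorCoeff_eq : ∀ n : ℕ, taylorCoeff f n = a₀ (n + 1)

variable {a₀ : ℕ → ℝ} {a : ℕ → ℝ → ℝ} {f : ℂ → ℂ} {t : ℝ}

theorem solvesShellSystem_taylorCoeff_evolve (hf : DifferentiableOn ℂ f (ball 0 1)) (s : Set ℝ) :
    SolvesShellSystem (fun n t => taylorCoeff (evolve f t) n) s := fun n t _ =>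
  (hasDerivAt_taylorCoeff_evolve hf n t).hasDerivWithinAt.congr_deriv (by simp)

theorem hasGeometricBound_taylorCoeff_evolve (hf : DifferentiableOn ℂ f (ball 0 1)) {K : Set ℝ}
    (hK : IsCompact K) : HasGeometricBound (fun n t => taylorCoeff (evolve f t) n) K := by
  have hsub : closedBall (0 : ℂ) (1 / 2) ⊆ ball 0 1 := closedBall_subset_ball (by norm_num)
  obtain ⟨C, hC⟩ := exists_norm_taylorCoeff_le_of_isCompact (F := evolve f) hK one_half_pos
    (fun t _ => (differentiableOn_evolve_ball hf t).diffContOnCl_ball hsub)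
    ((continuousOn_evolve_ball hf.continuousOn).mono
      (Set.prod_mono (Set.subset_univ _) (sphere_subset_closedBall.trans hsub)))
  exact ⟨C, 2, fun t ht n => by simpa [div_eq_mul_inv] using hC t ht n⟩

theorem IsSolution.solvesShellSystem (ha : IsSolution a₀ a) :
    SolvesShellSystem (fun n => a (n + 1)) (Set.Ici 0) := fun n t ht =>
  (ha.ode n t ht).congr_deriv (by cases n <;> simp)

theorem IsSolution.taylorCoeff_evolve_eq (ha : IsSolution a₀ a) (hf : IsGenerating a₀ f)
    (ht : 0 ≤ t) (n : ℕ) : taylorCoeff (evolve f t) n = a (n + 1) t := by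
  have hbound : HasGeometricBound (fun n t => (a (n + 1) t : ℂ)) (Set.Icc 0 t) := by
    obtain ⟨K, γ, hK⟩ := ha.growth t ht
    refine ⟨K * γ, γ, fun s hs n => ?_⟩
    rw [Complex.norm_real, Real.norm_eq_abs, mul_assoc, ← pow_succ']
    exact hK s hs.1 hs.2 (n + 1)
  have hsystem : SolvesShellSystem (fun n t => (a (n + 1) t : ℂ)) (Set.Icc 0 t) := fun n s hs =>
    ((ha.solvesShellSystem n s hs.1).mono Set.Icc_subset_Ici_self).ofReal_comp.congr_deriv
      (by simp)
  exact (solvesShellSystem_taylorCoeff_evolve hf.differentiableOn _).unique hsystem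
    (hasGeometricBound_taylorCoeff_evolve hf.differentiableOn isCompact_Icc) hbound
    (fun n => by rw [evolve_zero, hf.taylorCoeff_eq, ha.initial]) (Set.right_mem_Icc.mpr ht) n

theorem IsGenerating.exists_isSolution (hf : IsGenerating a₀ f) :
    ∃ a : ℕ → ℝ → ℝ, IsSolution a₀ a := by
  refine ⟨fun n t => n.casesOn 0 fun n => (taylorCoeff (evolve f t) n).re, fun t _ => rfl,
    fun n => ?_, fun n t _ => ?_, fun T _ => ?_⟩
  · simp [evolve_zero, hf.taylorCoeff_eq]
  · refine (Complex.reCLM.hasFDerivAt.comp_hasDerivAt t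
      (hasDerivAt_taylorCoeff_evolve hf.differentiableOn n t)).hasDerivWithinAt.congr_deriv ?_
    cases n <;> simp
  · obtain ⟨K, γ, hK, hγ, hbound⟩ := (hasGeometricBound_taylorCoeff_evolve hf.differentiableOn
      (isCompact_Icc (a := 0) (b := T))).exists_one_le
    refine ⟨K, γ, fun t h0 hT n => ?_⟩
    cases n with
    | zero => simpa using hK
    | succ n =>
      calc |(taylorCoeff (evolve f t) n).re| ≤ K * γ ^ n :=
            (Complex.abs_re_le_norm _).trans (hbound t ⟨h0, hT⟩ n)
        _ ≤ K * γ ^ (n + 1) := by gcongr; omega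

end ShellSolution

section Binomial

/-- The coefficients of the binomial series `(1 - z)^{-α} = ∑ (α)_n / n! zⁿ`, where `(α)_n` is the
rising factorial. -/
noncomputable def binomCoeff (α : ℝ) (n : ℕ) : ℝ :=
  (∏ j ∈ Finset.range n, (α + j)) / n.factorial

variable {α : ℝ}

theorem binomCoeff_pos (hα : 0 < α) (n : ℕ) : 0 < binomCoeff α n :=
  div_pos (Finset.prod_pos fun _ _ => by positivity) (by positivity)

theorem choose_eq_binomCoeff (α : ℝ) (n : ℕ) :
    Ring.choose (α + n - 1 : ℝ) n = binomCoeff α n := by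
  have hpoch (m : ℕ) : (ascPochhammer ℝ m).eval α = ∏ j ∈ Finset.range m, (α + j) := by
    induction m with
    | zero => simp
    | succ m ih => rw [ascPochhammer_succ_eval, ih, Finset.prod_range_succ]
  have hfac : (n.factorial : ℝ) ≠ 0 := mod_cast n.factorial_ne_zero
  rw [binomCoeff, eq_div_iff hfac, mul_comm, ← nsmul_eq_mul, ← Ring.multichoose_eq,
    Ring.factorial_nsmul_multichoose_eq_ascPochhammer, Polynomial.ascPochhammer_smeval_eq_eval,
    hpoch]

theorem hasSum_binomCoeff (α : ℝ) {z : ℂ} (hz : ‖z‖ < 1) :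
    HasSum (fun n : ℕ => (binomCoeff α n : ℂ) * z ^ n) ((1 - z) ^ (-(α : ℂ))) := by
  have hz' : z ∈ Metric.eball (0 : ℂ) 1 := by
    rwa [← ENNReal.ofReal_one, eball_ofReal, mem_ball_zero_iff]
  have hsum := (Complex.one_div_one_sub_cpow_hasFPowerSeriesOnBall_zero (α : ℂ)).hasSum hz'
  rw [zero_add, one_div, ← Complex.cpow_neg] at hsum
  refine hsum.congr_fun fun n => ?_
  simp only [FormalMultilinearSeries.ofScalars_apply_eq, ← choose_eq_binomCoeff,
    Complex.ofReal_choose, smul_eq_mul]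
  push_cast
  rfl

theorem tendsto_binomCoeff (hα : 0 < α) :
    Tendsto (fun n : ℕ => binomCoeff α n / (n : ℝ) ^ (α - 1)) atTop (𝓝 (Real.Gamma α)⁻¹) := by
  have hlim := ((Real.GammaSeq_tendsto_Gamma α).inv₀ (Real.Gamma_pos_of_pos hα).ne').mul
    (tendsto_natCast_div_add_atTop α)
  rw [mul_one] at hlim
  refine hlim.congr' ?_
  filter_upwards [eventually_gt_atTop 0] with n hn
  have hn : (0 : ℝ) < n := mod_cast hn
  have hpow : (n : ℝ) ^ α ≠ 0 := (Real.rpow_pos_of_pos hn _).ne'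
  have hadd : α + n ≠ 0 := by positivity
  rw [Real.GammaSeq, binomCoeff, Finset.prod_range_succ, Real.rpow_sub_one hn.ne', add_comm _ α]
  field_simp

theorem hasSum_one_add_cpow (α : ℝ) {z : ℂ} (hz : ‖z‖ < 1) :
    HasSum (fun n : ℕ => ((-1) ^ n * binomCoeff α n : ℂ) * z ^ n) ((1 + z) ^ (-(α : ℂ))) := by
  have hsum := hasSum_binomCoeff α (z := -z) (by rwa [norm_neg])
  rw [sub_neg_eq_add] at hsum
  refine hsum.congr_fun fun n => ?_
  rw [neg_pow]
  ring

theorem taylorCoeff_one_add_cpow (α : ℝ) (n : ℕ) :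
    taylorCoeff (fun z : ℂ => (1 + z) ^ (-(α : ℂ))) n = (-1) ^ n * binomCoeff α n := by
  refine taylorCoeff_eq_of_hasSum (c := fun n => (-1) ^ n * (binomCoeff α n : ℂ)) ?_ n
  filter_upwards [ball_mem_nhds (0 : ℂ) one_pos] with z hz
  exact hasSum_one_add_cpow α (mem_ball_zero_iff.mp hz)

end Binomial

section OneAdd

variable {z : ℂ}

theorem ball_subset_closedBall_diff : ball (0 : ℂ) 1 ⊆ closedBall 0 1 \ {-1} := fun z hz =>
  ⟨ball_subset_closedBall hz, fun h => by simp [Set.mem_singleton_iff.mp h] at hz⟩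

theorem re_one_add_pos (hz : z ∈ closedBall (0 : ℂ) 1 \ {-1}) : 0 < (1 + z).re := by
  have hnorm : z.re * z.re + z.im * z.im ≤ 1 := by
    rw [← Complex.normSq_apply, Complex.normSq_eq_norm_sq]
    exact pow_le_one₀ (norm_nonneg z) (mem_closedBall_zero_iff.mp hz.1)
  rw [Complex.add_re, Complex.one_re]
  by_contra! hre
  have hre' : z.re = -1 := by nlinarith [mul_self_nonneg z.im]
  exact hz.2 (Complex.ext hre' (by simpa using by nlinarith))

theorem norm_one_add_pos (hz : z ≠ -1) : 0 < ‖1 + z‖ :=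
  norm_pos_iff.mpr fun h => hz (eq_neg_of_add_eq_zero_right h)

end OneAdd

section Transfer

theorem norm_circleAverage_le_circleAverage {E : Type*} [NormedAddCommGroup E] [NormedSpace ℝ E]
    {f : ℂ → E} {g : ℂ → ℝ} {c : ℂ} {R : ℝ} (hg : CircleIntegrable g c R)
    (hfg : ∀ z ∈ sphere c |R|, ‖f z‖ ≤ g z) :
    ‖Real.circleAverage f c R‖ ≤ Real.circleAverage g c R := by
  have hpi := Real.two_pi_pos
  rw [Real.circleAverage, Real.circleAverage, norm_smul, smul_eq_mul, norm_inv,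
    Real.norm_of_nonneg hpi.le]
  gcongr
  exact intervalIntegral.norm_integral_le_of_norm_le hpi.le
    (Eventually.of_forall fun θ _ => hfg _ (circleMap_mem_sphere' c R θ)) hg

theorem one_sub_add_abs_sub_pi_le_norm_one_add_circleMap {r θ : ℝ} (hr : 1 / 2 ≤ r)
    (hθ : |θ - Real.pi| ≤ Real.pi) :
    (1 - r + |θ - Real.pi|) / 5 ≤ ‖1 + circleMap 0 r θ‖ := by
  have hcos : Real.cos (θ - Real.pi) ≤ 1 - 1 / 5 * (θ - Real.pi) ^ 2 := by
    refine (Real.cos_le_one_sub_mul_cos_sq hθ).trans ?_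
    have hpi : Real.pi ^ 2 ≤ 10 := by nlinarith [Real.pi_lt_d2, Real.pi_pos]
    have hconst : 1 / 5 ≤ 2 / Real.pi ^ 2 := by
      rw [div_le_div_iff₀ (by norm_num) (by positivity)]
      linarith
    gcongr
  have hnorm : ‖1 + circleMap 0 r θ‖ ^ 2 = (1 - r) ^ 2 + 2 * r * (1 - Real.cos (θ - Real.pi)) := by
    rw [← Complex.normSq_eq_norm_sq, Complex.normSq_apply, Real.cos_sub_pi, Complex.add_re,
      Complex.add_im, circleMap_zero_re, circleMap_zero_im, Complex.one_re, Complex.one_im]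
    linear_combination r ^ 2 * Real.sin_sq_add_cos_sq θ
  have hcos' : 1 / 2 * (1 / 5 * |θ - Real.pi| ^ 2) ≤ r * (1 - Real.cos (θ - Real.pi)) := by
    rw [sq_abs]
    exact mul_le_mul hr (by linarith) (by positivity) (by linarith)
  refine le_of_sq_le_sq ?_ (norm_nonneg _)
  rw [hnorm]
  nlinarith [sq_nonneg (1 - r - |θ - Real.pi|)]

variable {α : ℝ}

theorem norm_one_add_circleMap_rpow_le {r θ : ℝ} (hα : -1 ≤ α) (hr : 1 / 2 ≤ r) (hr1 : r < 1)
    (hθ : |θ - Real.pi| ≤ Real.pi) :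
    ‖1 + circleMap 0 r θ‖ ^ (-α - 1) ≤
      5 ^ (α + 1) * (1 - r) ^ (-α - 1) * (1 + ‖(θ - Real.pi) / (1 - r)‖) ^ (-(α + 1)) := by
  have hδ : 0 < 1 - r := sub_pos.mpr hr1
  have heq : (1 - r + |θ - Real.pi|) / 5 =
      5⁻¹ * ((1 - r) * (1 + ‖(θ - Real.pi) / (1 - r)‖)) := by
    rw [norm_div, Real.norm_of_nonneg hδ.le, Real.norm_eq_abs]
    field_simp
  refine (Real.rpow_le_rpow_of_nonpos (by positivity)
    (one_sub_add_abs_sub_pi_le_norm_one_add_circleMap hr hθ) (by linarith)).trans_eq ?_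
  rw [heq, Real.mul_rpow (by norm_num) (by positivity), Real.mul_rpow hδ.le (by positivity),
    Real.inv_rpow (by norm_num), ← Real.rpow_neg (by norm_num), neg_sub, sub_neg_eq_add,
    add_comm 1 α, neg_add' α 1, mul_assoc]

theorem exists_circleAverage_norm_one_add_rpow_le (hα : 0 < α) :
    ∃ M : ℝ, 0 < M ∧ ∀ r : ℝ, 1 / 2 ≤ r → r < 1 →
      Real.circleAverage (fun z => ‖1 + z‖ ^ (-α - 1)) 0 r ≤ M * (1 - r) ^ (-α) := by
  have hint : MeasureTheory.Integrable fun x : ℝ => (1 + ‖x‖) ^ (-(α + 1)) :=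
    integrable_one_add_norm (by simpa using hα)
  refine ⟨max ((2 * Real.pi)⁻¹ * (5 ^ (α + 1) * ∫ x : ℝ, (1 + ‖x‖) ^ (-(α + 1)))) 1,
    by positivity, fun r hr hr1 => ?_⟩
  have hδ : 0 < 1 - r := by linarith
  have hpointwise : ∀ θ ∈ Set.Ioc 0 (2 * Real.pi), ‖1 + circleMap 0 r θ‖ ^ (-α - 1) ≤
      5 ^ (α + 1) * (1 - r) ^ (-α - 1) * (1 + ‖(θ - Real.pi) / (1 - r)‖) ^ (-(α + 1)) := fun θ hθ =>
    norm_one_add_circleMap_rpow_le (by linarith) hr hr1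
      (abs_le.mpr ⟨by linarith [hθ.1], by linarith [hθ.2]⟩)
  have hmajorant := ((hint.comp_div hδ.ne').comp_sub_right Real.pi).const_mul
    (5 ^ (α + 1) * (1 - r) ^ (-α - 1))
  calc Real.circleAverage (fun z => ‖1 + z‖ ^ (-α - 1)) 0 r
      ≤ (2 * Real.pi)⁻¹ * ∫ θ : ℝ, 5 ^ (α + 1) * (1 - r) ^ (-α - 1) *
          (1 + ‖(θ - Real.pi) / (1 - r)‖) ^ (-(α + 1)) := by
        rw [Real.circleAverage, smul_eq_mul,
          intervalIntegral.integral_of_le Real.two_pi_pos.le]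
        gcongr
        refine (MeasureTheory.integral_mono_of_nonneg ?_ hmajorant.integrableOn
          (MeasureTheory.ae_restrict_of_forall_mem measurableSet_Ioc hpointwise)).trans
          (MeasureTheory.setIntegral_le_integral hmajorant ?_)
        · exact Eventually.of_forall fun _ => by positivity
        · exact Eventually.of_forall fun _ => by positivity
    _ = (2 * Real.pi)⁻¹ * (5 ^ (α + 1) * ∫ x : ℝ, (1 + ‖x‖) ^ (-(α + 1))) * (1 - r) ^ (-α) := by
        rw [MeasureTheory.integral_const_mul,
          MeasureTheory.integral_sub_right_eq_self
            (fun θ => (1 + ‖θ / (1 - r)‖) ^ (-(α + 1))) Real.pi,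
          MeasureTheory.Measure.integral_comp_div (fun x => (1 + ‖x‖) ^ (-(α + 1))),
          abs_of_pos hδ, smul_eq_mul, Real.rpow_sub_one hδ.ne']
        field_simp
    _ ≤ _ := by gcongr; exact le_max_left _ _

theorem isLittleO_of_forall_exists_le_mul_add {ι E : Type*} [NormedAddCommGroup E] {l : Filter ι}
    {u : ι → E} {v : ι → ℝ} (hv : Tendsto v l atTop)
    (h : ∀ ε > 0, ∃ C, ∀ᶠ n in l, ‖u n‖ ≤ ε * v n + C) : u =o[l] v := by
  refine isLittleO_iff.mpr fun c hc => ?_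
  obtain ⟨C, hC⟩ := h (c / 2) (half_pos hc)
  filter_upwards [hC, hv.eventually_ge_atTop 0,
    hv.eventually_ge_atTop (C / (c / 2))] with n hn hpos hlarge
  rw [div_le_iff₀ (half_pos hc)] at hlarge
  rw [Real.norm_of_nonneg hpos]
  linarith

theorem norm_taylorCoeff_le_of_norm_le {g : ℂ → ℂ} {ε C r : ℝ} (hr : 0 < r) (hr1 : r < 1)
    (hg : DifferentiableOn ℂ g (ball 0 1))
    (hbound : ∀ z ∈ ball (0 : ℂ) 1, ‖g z‖ ≤ ε * ‖1 + z‖ ^ (-α - 1) + C) (n : ℕ) :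
    ‖taylorCoeff g n‖ ≤
      (r ^ n)⁻¹ * (ε * Real.circleAverage (fun z => ‖1 + z‖ ^ (-α - 1)) 0 r + C) := by
  have hsub : sphere (0 : ℂ) |r| ⊆ ball 0 1 := fun z hz => by
    rwa [mem_ball_zero_iff, mem_sphere_zero_iff_norm.mp hz, abs_of_pos hr]
  have hcont : ContinuousOn (fun z : ℂ => ‖1 + z‖ ^ (-α - 1)) (sphere 0 |r|) :=
    ContinuousOn.rpow_const (by fun_prop) fun z hz =>
      .inl (norm_one_add_pos (ball_subset_closedBall_diff (hsub hz)).2).ne'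
  have haverage : Real.circleAverage (fun z => (r ^ n)⁻¹ * (ε * ‖1 + z‖ ^ (-α - 1) + C)) 0 r =
      (r ^ n)⁻¹ * (ε * Real.circleAverage (fun z => ‖1 + z‖ ^ (-α - 1)) 0 r + C) := by
    simp only [← smul_eq_mul]
    rw [Real.circleAverage_fun_smul, Real.circleAverage_fun_add
      (f₁ := fun z => ε • ‖1 + z‖ ^ (-α - 1)) (hcont.const_smul ε).circleIntegrable'
      continuousOn_const.circleIntegrable',
      Real.circleAverage_fun_smul, Real.circleAverage_const]
  rw [taylorCoeff_eq_circleAverage hr (hg.diffContOnCl_ball (closedBall_subset_ball hr1)),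
    ← haverage]
  refine norm_circleAverage_le_circleAverage (ContinuousOn.circleIntegrable' (by fun_prop))
    fun z hz => ?_
  rw [norm_div, norm_pow, mem_sphere_zero_iff_norm.mp hz, abs_of_pos hr, div_eq_inv_mul]
  gcongr
  exact hbound z (hsub hz)

theorem taylorCoeff_isLittleO_of_norm_le (hα : 0 < α) {g : ℂ → ℂ}
    (hg : DifferentiableOn ℂ g (ball 0 1))
    (hbound : ∀ ε > 0, ∃ C, ∀ z ∈ ball (0 : ℂ) 1, ‖g z‖ ≤ ε * ‖1 + z‖ ^ (-α - 1) + C) :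
    taylorCoeff g =o[atTop] fun n : ℕ => (n : ℝ) ^ α := by
  obtain ⟨M, hM, hcircle⟩ := exists_circleAverage_norm_one_add_rpow_le hα
  refine isLittleO_of_forall_exists_le_mul_add
    ((tendsto_rpow_atTop hα).comp tendsto_natCast_atTop_atTop) fun ε hε => ?_
  obtain ⟨C, hC⟩ := hbound (ε / (Real.exp 1 * M * 2 ^ α)) (by positivity)
  refine ⟨Real.exp 1 * |C|, (eventually_ge_atTop 1).mono fun n hn => ?_⟩
  have hn : (1 : ℝ) ≤ n := mod_cast hn
  -- The radius `1 - 1 / (n + 1)` balances the factor `r⁻ⁿ` against the growth at `-1`.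
  set r : ℝ := n / (n + 1) with hr
  have hr_half : 1 / 2 ≤ r := by
    rw [hr, div_le_div_iff₀ (by norm_num) (by positivity)]
    linarith
  have hr1 : r < 1 := (div_lt_one (by positivity)).mpr (lt_add_one _)
  have hpow : (r ^ n)⁻¹ ≤ Real.exp 1 := by
    rw [← inv_pow, hr, inv_div, add_div, div_self (by positivity), one_div]
    exact Real.one_add_inv_pow_le_exp
  have hδ : (1 - r) ^ (-α) ≤ 2 ^ α * (n : ℝ) ^ α := by
    have heq : 1 - r = (n + 1 : ℝ)⁻¹ := by
      rw [hr]
      field_simp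
      ring
    rw [heq, Real.inv_rpow (by positivity), Real.rpow_neg (by positivity), inv_inv,
      ← Real.mul_rpow (by norm_num) (by positivity)]
    gcongr
    linarith
  calc ‖taylorCoeff g n‖
      ≤ (r ^ n)⁻¹ * (ε / (Real.exp 1 * M * 2 ^ α) *
          Real.circleAverage (fun z => ‖1 + z‖ ^ (-α - 1)) 0 r + C) :=
        norm_taylorCoeff_le_of_norm_le (by positivity) hr1 hg hC n
    _ ≤ (r ^ n)⁻¹ * (ε / (Real.exp 1 * M * 2 ^ α) * (M * (2 ^ α * (n : ℝ) ^ α)) + |C|) := by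
        gcongr
        · exact (hcircle r hr_half hr1).trans (by gcongr)
        · exact le_abs_self C
    _ ≤ Real.exp 1 * (ε / (Real.exp 1 * M * 2 ^ α) * (M * (2 ^ α * (n : ℝ) ^ α)) + |C|) := by
        gcongr
    _ = ε * (n : ℝ) ^ α + Real.exp 1 * |C| := by field_simp

end Transfer

section LowerOrder

/-- `h` is analytic on the closed unit disk away from `-1` and of lower order than `(1 + z)^{-α}`
at `-1`, together with its derivative; subtracting the leading singularity `A (1 + z)^{-α}` of a
generating function leaves such a remainder. -/
structure IsLowerOrder (α : ℝ) (h : ℂ → ℂ) : Prop where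
  analyticOnNhd : AnalyticOnNhd ℂ h (closedBall 0 1 \ {-1})
  isLittleO : h =o[𝓝[ball 0 1] (-1)] fun z => ‖1 + z‖ ^ (-α)
  deriv_isLittleO : deriv h =o[𝓝[ball 0 1] (-1)] fun z => ‖1 + z‖ ^ (-α - 1)

variable {α : ℝ} {f g h χ : ℂ → ℂ}

theorem tendsto_norm_one_add : Tendsto (fun z : ℂ => ‖1 + z‖) (𝓝[ball 0 1] (-1)) (𝓝 0) := by
  have hcont : Continuous fun z : ℂ => ‖1 + z‖ := by fun_prop
  simpa using (hcont.tendsto (-1)).mono_left nhdsWithin_le_nhds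

theorem norm_one_add_rpow_isLittleO (α : ℝ) :
    (fun z : ℂ => ‖1 + z‖ ^ (-α)) =o[𝓝[ball 0 1] (-1)] fun z => ‖1 + z‖ ^ (-α - 1) := by
  have hmul := ((isLittleO_one_iff ℝ).mpr tendsto_norm_one_add).mul_isBigO
    (isBigO_refl (fun z : ℂ => ‖1 + z‖ ^ (-α - 1)) (𝓝[ball 0 1] (-1)))
  refine hmul.congr' ?_ (Eventually.of_forall fun z => one_mul _)
  filter_upwards [self_mem_nhdsWithin] with z hz
  have hpos := norm_one_add_pos (ball_subset_closedBall_diff hz).2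
  rw [Real.rpow_sub_one hpos.ne', mul_div_cancel₀ _ hpos.ne']

theorem exists_norm_le_of_isLittleO {s : ℝ} (hg : ContinuousOn g (closedBall 0 1 \ {-1}))
    (ho : g =o[𝓝[ball 0 1] (-1)] fun z => ‖1 + z‖ ^ s) {ε : ℝ} (hε : 0 < ε) :
    ∃ C : ℝ, ∀ z ∈ ball (0 : ℂ) 1, ‖g z‖ ≤ ε * ‖1 + z‖ ^ s + C := by
  obtain ⟨δ, hδ, hnear⟩ := mem_nhdsWithin_iff.mp (ho.def hε)
  have hcompact : IsCompact (closedBall (0 : ℂ) 1 \ ball (-1) δ) :=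
    (isCompact_closedBall 0 1).diff isOpen_ball
  obtain ⟨C, hC⟩ := hcompact.exists_bound_of_continuousOn
    (hg.mono (Set.sdiff_subset_sdiff_right (Set.singleton_subset_iff.mpr (mem_ball_self hδ))))
  refine ⟨|C|, fun z hz => ?_⟩
  by_cases hzδ : z ∈ ball (-1) δ
  · have hle : ‖g z‖ ≤ ε * ‖‖1 + z‖ ^ s‖ := hnear ⟨hzδ, hz⟩
    rw [Real.norm_of_nonneg (by positivity)] at hle
    linarith [abs_nonneg C]
  · exact (hC z ⟨ball_subset_closedBall hz, hzδ⟩).trans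
      ((le_abs_self C).trans (le_add_of_nonneg_left (by positivity)))

theorem isBigO_one_of_analyticOnNhd (hχ : AnalyticOnNhd ℂ χ (closedBall 0 1)) :
    χ =O[𝓝[ball 0 1] (-1)] fun _ => (1 : ℝ) :=
  ((hχ (-1) (by simp)).continuousAt.tendsto.mono_left nhdsWithin_le_nhds).isBigO_one ℝ

namespace IsLowerOrder

theorem differentiableOn (hh : IsLowerOrder α h) : DifferentiableOn ℂ h (ball 0 1) :=
  (hh.analyticOnNhd.mono ball_subset_closedBall_diff).differentiableOn

theorem congr (hg : IsLowerOrder α g)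
    (heq : ∀ z ∈ closedBall (0 : ℂ) 1 \ {-1}, g =ᶠ[𝓝 z] h) : IsLowerOrder α h where
  analyticOnNhd z hz := (hg.analyticOnNhd z hz).congr (heq z hz)
  isLittleO := hg.isLittleO.congr' (eventually_mem_nhdsWithin.mono fun z hz =>
    (heq z (ball_subset_closedBall_diff hz)).eq_of_nhds) EventuallyEq.rfl
  deriv_isLittleO := hg.deriv_isLittleO.congr' (eventually_mem_nhdsWithin.mono fun z hz =>
    (heq z (ball_subset_closedBall_diff hz)).deriv_eq) EventuallyEq.rfl

theorem add (hg : IsLowerOrder α g) (hh : IsLowerOrder α h) :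
    IsLowerOrder α fun z => g z + h z where
  analyticOnNhd := fun z hz => (hg.analyticOnNhd z hz).fun_add (hh.analyticOnNhd z hz)
  isLittleO := hg.isLittleO.add hh.isLittleO
  deriv_isLittleO := (hg.deriv_isLittleO.add hh.deriv_isLittleO).congr'
    (eventually_mem_nhdsWithin.mono fun z hz =>
      have hz' := ball_subset_closedBall_diff hz
      (deriv_fun_add (hg.analyticOnNhd z hz').differentiableAt
        (hh.analyticOnNhd z hz').differentiableAt).symm) EventuallyEq.rfl

theorem analytic_mul (hχ : AnalyticOnNhd ℂ χ (closedBall 0 1)) (hh : IsLowerOrder α h) :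
    IsLowerOrder α fun z => χ z * h z where
  analyticOnNhd := fun z hz => (hχ z hz.1).fun_mul (hh.analyticOnNhd z hz)
  isLittleO := by simpa using (isBigO_one_of_analyticOnNhd hχ).mul_isLittleO hh.isLittleO
  deriv_isLittleO := by
    have hfirst : (fun z => deriv χ z * h z) =o[𝓝[ball 0 1] (-1)] fun z => ‖1 + z‖ ^ (-α - 1) := by
      simpa using (isBigO_one_of_analyticOnNhd hχ.deriv).mul_isLittleO
        (hh.isLittleO.trans (norm_one_add_rpow_isLittleO α))
    have hsecond : (fun z => χ z * deriv h z) =o[𝓝[ball 0 1] (-1)] fun z => ‖1 + z‖ ^ (-α - 1) := by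
      simpa using (isBigO_one_of_analyticOnNhd hχ).mul_isLittleO hh.deriv_isLittleO
    refine (hfirst.add hsecond).congr' (eventually_mem_nhdsWithin.mono fun z hz => ?_)
      EventuallyEq.rfl
    have hz' := ball_subset_closedBall_diff hz
    exact (deriv_fun_mul (hχ z hz'.1).differentiableAt
      (hh.analyticOnNhd z hz').differentiableAt).symm

end IsLowerOrder

theorem norm_cpow_neg_ofReal (w : ℂ) (α : ℝ) : ‖w ^ (-(α : ℂ))‖ = ‖w‖ ^ (-α) := by
  rw [← Complex.ofReal_neg, Complex.norm_cpow_real]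

theorem norm_cpow_neg_ofReal_sub_one (w : ℂ) (α : ℝ) :
    ‖w ^ (-(α : ℂ) - 1)‖ = ‖w‖ ^ (-α - 1) := by
  rw [← Complex.norm_cpow_real]
  push_cast
  rfl

theorem hasDerivAt_one_add_cpow (α : ℝ) {z : ℂ} (hz : 0 < (1 + z).re) :
    HasDerivAt (fun z : ℂ => (1 + z) ^ (-(α : ℂ))) (-(α : ℂ) * (1 + z) ^ (-(α : ℂ) - 1)) z := by
  simpa using ((hasDerivAt_id' z).const_add 1).cpow_const (c := -(α : ℂ)) (Or.inl hz)

theorem analyticOnNhd_one_add_cpow (α : ℝ) :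
    AnalyticOnNhd ℂ (fun z : ℂ => (1 + z) ^ (-(α : ℂ))) (closedBall 0 1 \ {-1}) := fun _ hz =>
  (analyticAt_const.add analyticAt_id).cpow analyticAt_const (Or.inl (re_one_add_pos hz))

theorem isLowerOrder_sub_mul_one_add_cpow (α : ℝ) (hχ : AnalyticOnNhd ℂ χ (closedBall 0 1)) :
    IsLowerOrder α fun z => (χ z - χ (-1)) * (1 + z) ^ (-(α : ℂ)) := by
  have hsub : AnalyticOnNhd ℂ (fun z => χ z - χ (-1)) (closedBall 0 1) :=
    fun z hz => (hχ z hz).fun_sub analyticAt_const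
  have hvanish : (fun z => χ z - χ (-1)) =o[𝓝[ball 0 1] (-1)] fun _ => (1 : ℝ) := by
    rw [isLittleO_one_iff]
    simpa using ((hsub (-1) (by simp)).continuousAt.tendsto).mono_left nhdsWithin_le_nhds
  have hcpow (l : Filter ℂ) :
      (fun z : ℂ => (1 + z) ^ (-(α : ℂ))) =O[l] fun z => ‖1 + z‖ ^ (-α) := by
    simpa only [norm_cpow_neg_ofReal] using
      (isBigO_refl (fun z : ℂ => (1 + z) ^ (-(α : ℂ))) l).norm_right
  have hcpow' : (fun z : ℂ => -(α : ℂ) * (1 + z) ^ (-(α : ℂ) - 1)) =O[𝓝[ball 0 1] (-1)]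
      fun z => ‖1 + z‖ ^ (-α - 1) := by
    simpa only [norm_cpow_neg_ofReal_sub_one] using
      ((isBigO_refl (fun z : ℂ => (1 + z) ^ (-(α : ℂ) - 1)) _).norm_right.const_mul_left (-(α : ℂ)))
  refine ⟨fun z hz => (hsub z hz.1).fun_mul (analyticOnNhd_one_add_cpow α z hz),
    by simpa using hvanish.mul_isBigO (hcpow _), ?_⟩
  have hfirst : (fun z => deriv (fun z => χ z - χ (-1)) z * (1 + z) ^ (-(α : ℂ)))
      =o[𝓝[ball 0 1] (-1)] fun z => ‖1 + z‖ ^ (-α - 1) := by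
    simpa using (isBigO_one_of_analyticOnNhd hsub.deriv).mul_isLittleO
      ((hcpow _).trans_isLittleO (norm_one_add_rpow_isLittleO α))
  have hsecond := hvanish.mul_isBigO hcpow'
  simp only [one_mul] at hsecond
  refine (hfirst.add hsecond).congr' (eventually_mem_nhdsWithin.mono fun z hz => ?_)
    EventuallyEq.rfl
  have hz' := ball_subset_closedBall_diff hz
  exact ((hsub z hz'.1).differentiableAt.hasDerivAt.mul
    (hasDerivAt_one_add_cpow α (re_one_add_pos hz'))).deriv.symm

end LowerOrder

section FlowLowerOrder

variable {α : ℝ} {f h : ℂ → ℂ} {t : ℝ} {z : ℂ}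

theorem analyticOnNhd_flowDen (t : ℝ) : AnalyticOnNhd ℂ (flowDen t) (closedBall 0 1) :=
  fun z _ => (differentiable_flowDen t).analyticAt z

theorem analyticOnNhd_inv_flowDen (t : ℝ) :
    AnalyticOnNhd ℂ (fun z => (flowDen t z)⁻¹) (closedBall 0 1) :=
  (analyticOnNhd_flowDen t).fun_inv fun _ hz => flowDen_ne_zero t (mem_closedBall_zero_iff.mp hz)

theorem analyticOnNhd_flowDen_cpow (t : ℝ) (s : ℂ) :
    AnalyticOnNhd ℂ (fun z => flowDen t z ^ s) (closedBall 0 1) := fun z hz =>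
  (analyticOnNhd_flowDen t z hz).cpow analyticAt_const
    (Or.inl (re_flowDen_pos t (mem_closedBall_zero_iff.mp hz)))

theorem analyticOnNhd_flow (t : ℝ) : AnalyticOnNhd ℂ (flow t) (closedBall 0 1) := fun z hz =>
  ((analyticAt_id.mul analyticAt_const).sub analyticAt_const).fun_div (analyticOnNhd_flowDen t z hz)
    (flowDen_ne_zero t (mem_closedBall_zero_iff.mp hz))

theorem flow_neg_one (t : ℝ) : flow t (-1) = -1 := by
  have hden : flowDen t (-1) ≠ 0 := flowDen_ne_zero t (by simp)
  linear_combination one_add_flow hden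

theorem one_add_flow_ne_zero (hz : z ∈ closedBall (0 : ℂ) 1 \ {-1}) : 1 + flow t z ≠ 0 := by
  have hden := flowDen_ne_zero t (mem_closedBall_zero_iff.mp hz.1)
  rw [one_add_flow hden]
  exact div_ne_zero (mul_ne_zero (mod_cast (Real.exp_pos _).ne')
    (norm_pos_iff.mp (norm_one_add_pos hz.2))) hden

theorem mapsTo_flow_closedBall_diff (t : ℝ) :
    Set.MapsTo (flow t) (closedBall 0 1 \ {-1}) (closedBall 0 1 \ {-1}) := fun z hz =>
  ⟨mem_closedBall_zero_iff.mpr (norm_flow_le_one t (mem_closedBall_zero_iff.mp hz.1)),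
    fun h => one_add_flow_ne_zero (t := t) hz (by rw [Set.mem_singleton_iff.mp h, add_neg_cancel])⟩

theorem tendsto_flow_neg_one (t : ℝ) :
    Tendsto (flow t) (𝓝[ball 0 1] (-1)) (𝓝[ball 0 1] (-1)) := by
  refine tendsto_nhdsWithin_iff.mpr ⟨?_, eventually_mem_nhdsWithin.mono (mapsTo_flow_ball t)⟩
  have hcont := (analyticOnNhd_flow t (-1) (by simp)).continuousAt.tendsto
  rw [flow_neg_one] at hcont
  exact hcont.mono_left nhdsWithin_le_nhds

theorem norm_one_add_flow_rpow_isBigO (t s : ℝ) :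
    (fun z => ‖1 + flow t z‖ ^ s) =O[𝓝[ball 0 1] (-1)] fun z => ‖1 + z‖ ^ s := by
  have hfactor : (fun z => ‖(Real.exp (-t) : ℂ) * (flowDen t z)⁻¹‖ ^ s) =O[𝓝[ball 0 1] (-1)]
      fun _ => (1 : ℝ) := by
    have hcont : ContinuousAt (fun z => ‖(Real.exp (-t) : ℂ) * (flowDen t z)⁻¹‖ ^ s) (-1) := by
      refine ContinuousAt.rpow_const ((analyticOnNhd_inv_flowDen t (-1)
        (by simp)).continuousAt.const_mul _).norm (Or.inl (norm_ne_zero_iff.mpr ?_))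
      exact mul_ne_zero (mod_cast (Real.exp_pos _).ne') (inv_ne_zero (flowDen_ne_zero t (by simp)))
    exact (hcont.tendsto.mono_left nhdsWithin_le_nhds).isBigO_one ℝ
  refine (hfactor.mul (isBigO_refl (fun z : ℂ => ‖1 + z‖ ^ s) _)).congr'
    (eventually_mem_nhdsWithin.mono fun z hz => ?_) (Eventually.of_forall fun z => one_mul _)
  simp only
  rw [← Real.mul_rpow (norm_nonneg _) (norm_nonneg _), ← norm_mul,
    one_add_flow (flowDen_ne_zero t (mem_ball_zero_iff.mp hz).le), mul_right_comm, div_eq_mul_inv]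

theorem IsLowerOrder.comp_flow (hh : IsLowerOrder α h) (t : ℝ) :
    IsLowerOrder α fun z => h (flow t z) where
  analyticOnNhd := hh.analyticOnNhd.comp ((analyticOnNhd_flow t).mono Set.sdiff_subset)
    (mapsTo_flow_closedBall_diff t)
  isLittleO := (hh.isLittleO.comp_tendsto (tendsto_flow_neg_one t)).trans_isBigO
    (norm_one_add_flow_rpow_isBigO t (-α))
  deriv_isLittleO := by
    have hmul := ((hh.deriv_isLittleO.comp_tendsto (tendsto_flow_neg_one t)).trans_isBigO
      (norm_one_add_flow_rpow_isBigO t (-α - 1))).mul_isBigO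
      (isBigO_one_of_analyticOnNhd (analyticOnNhd_flow t).deriv)
    simp only [mul_one] at hmul
    refine hmul.congr' (eventually_mem_nhdsWithin.mono fun z hz => ?_) EventuallyEq.rfl
    exact (deriv_comp z (hh.analyticOnNhd _ (ball_subset_closedBall_diff
      (mapsTo_flow_ball t hz))).differentiableAt
      (analyticOnNhd_flow t z (ball_subset_closedBall hz)).differentiableAt).symm

theorem log_div_of_re_pos {a b : ℂ} (ha : 0 < a.re) (hb : 0 < b.re) :
    Complex.log (a / b) = Complex.log a - Complex.log b := by
  have hargA := abs_lt.mp (Complex.abs_arg_lt_pi_div_two_iff.mpr (Or.inl ha))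
  have hargB := abs_lt.mp (Complex.abs_arg_lt_pi_div_two_iff.mpr (Or.inl hb))
  have hb_ne : b.arg ≠ Real.pi := by linarith [hargB.2, Real.pi_pos]
  have harg : b⁻¹.arg = -b.arg := by rw [Complex.arg_inv, if_neg hb_ne]
  rw [div_eq_mul_inv, Complex.log_mul (Complex.ne_zero_of_re_pos ha)
    (inv_ne_zero (Complex.ne_zero_of_re_pos hb)), Complex.log_inv _ hb_ne, sub_eq_add_neg]
  rw [harg]
  constructor <;> linarith [hargA.1, hargA.2, hargB.1, hargB.2]

theorem one_add_flow_cpow (α : ℝ) (hz : 0 < (1 + z).re) (hden : 0 < (flowDen t z).re) :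
    (1 + flow t z) ^ (-(α : ℂ)) =
      Real.exp (α * t) * (1 + z) ^ (-(α : ℂ)) * flowDen t z ^ (α : ℂ) := by
  have hz_ne := Complex.ne_zero_of_re_pos hz
  have hden_ne := Complex.ne_zero_of_re_pos hden
  have hexp : (Real.exp (-t) : ℂ) ≠ 0 := mod_cast (Real.exp_pos _).ne'
  rw [one_add_flow hden_ne, mul_div_assoc,
    Complex.cpow_def_of_ne_zero (mul_ne_zero hexp (div_ne_zero hz_ne hden_ne)),
    Complex.cpow_def_of_ne_zero hz_ne, Complex.cpow_def_of_ne_zero hden_ne,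
    Complex.ofReal_exp (α * t), ← Complex.exp_add, ← Complex.exp_add,
    Complex.log_ofReal_mul (Real.exp_pos _) (div_ne_zero hz_ne hden_ne), Real.log_exp,
    log_div_of_re_pos hz hden]
  congr 1
  push_cast
  ring

theorem flowDen_neg_one_cpow (α t : ℝ) :
    flowDen t (-1) ^ ((α : ℂ) - 1) = Real.exp ((α - 1) * t) := by
  have hcast : (α : ℂ) - 1 = ((α - 1 : ℝ) : ℂ) := by push_cast; rfl
  rw [flowDen_neg_one, hcast, ← Complex.ofReal_cpow (Real.exp_pos t).le, ← Real.exp_mul, mul_comm]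

theorem evolve_eq_add (A α : ℝ) (f : ℂ → ℂ) (hz : 0 < (1 + z).re) (hden : 0 < (flowDen t z).re) :
    evolve f t z = (flowDen t z)⁻¹ * (f (flow t z) - A * (1 + flow t z) ^ (-(α : ℂ))) +
      A * Real.exp (α * t) * flowDen t z ^ ((α : ℂ) - 1) * (1 + z) ^ (-(α : ℂ)) := by
  have hne := Complex.ne_zero_of_re_pos hden
  rw [one_add_flow_cpow α hz hden, Complex.cpow_sub _ _ hne, Complex.cpow_one, evolve]
  field_simp
  ring

theorem IsLowerOrder.evolve_sub {A : ℝ}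
    (hf : IsLowerOrder α fun z => f z - A * (1 + z) ^ (-(α : ℂ))) (t : ℝ) :
    IsLowerOrder α fun z => evolve f t z -
      (A * Real.exp ((2 * α - 1) * t) : ℝ) * (1 + z) ^ (-(α : ℂ)) := by
  have htransported := (hf.comp_flow t).analytic_mul (analyticOnNhd_inv_flowDen t)
  have hremainder := isLowerOrder_sub_mul_one_add_cpow α (χ := fun z =>
    A * Real.exp (α * t) * flowDen t z ^ ((α : ℂ) - 1))
    (fun z hz => analyticAt_const.fun_mul (analyticOnNhd_flowDen_cpow t _ z hz))
  refine (htransported.add hremainder).congr fun z hz => ?_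
  have hre : ∀ᶠ w in 𝓝 z, 0 < (1 + w).re :=
    ContinuousAt.eventually_lt (by fun_prop) (by fun_prop) (re_one_add_pos hz)
  have hden : ∀ᶠ w in 𝓝 z, 0 < (flowDen t w).re :=
    ContinuousAt.eventually_lt (by fun_prop)
      (Complex.continuous_re.continuousAt.comp (differentiable_flowDen t z).continuousAt)
      (re_flowDen_pos t (mem_closedBall_zero_iff.mp hz.1))
  filter_upwards [hre, hden] with w hw hw'
  have hexp : Real.exp ((2 * α - 1) * t) = Real.exp (α * t) * Real.exp ((α - 1) * t) := by
    rw [← Real.exp_add]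
    ring_nf
  rw [evolve_eq_add A α f hw hw', flowDen_neg_one_cpow, hexp]
  push_cast
  ring

theorem IsLowerOrder.taylorCoeff_isLittleO (hα : 0 < α) (hh : IsLowerOrder α h) :
    taylorCoeff h =o[atTop] fun n : ℕ => (n : ℝ) ^ (α - 1) := by
  have hderiv := taylorCoeff_isLittleO_of_norm_le hα (hh.differentiableOn.deriv isOpen_ball)
    fun ε hε => exists_norm_le_of_isLittleO hh.analyticOnNhd.deriv.continuousOn
      hh.deriv_isLittleO hε
  rw [← map_add_atTop_eq_nat 1, isLittleO_map]
  have hsucc : (fun n : ℕ => ((n + 1 : ℝ) : ℂ)⁻¹ * taylorCoeff (deriv h) n) =o[atTop]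
      fun n : ℕ => (n + 1 : ℝ)⁻¹ * (n + 1 : ℝ) ^ α := by
    refine IsBigO.mul_isLittleO ?_ (hderiv.trans_le fun n => ?_)
    · exact isBigO_of_le _ fun n => by rw [norm_inv, norm_inv, Complex.norm_real]
    · rw [Real.norm_of_nonneg (by positivity), Real.norm_of_nonneg (by positivity)]
      gcongr
      linarith
  refine hsucc.congr (fun n => ?_) fun n => ?_
  · have hne : (n + 1 : ℂ) ≠ 0 := mod_cast n.succ_ne_zero
    rw [taylorCoeff_deriv]
    push_cast
    rw [inv_mul_cancel_left₀ hne]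
    rfl
  · simp only [Function.comp_apply]
    push_cast
    rw [Real.rpow_sub_one (by positivity), inv_mul_eq_div]

end FlowLowerOrder

section DeltaRegion

variable {α η θ : ℝ} {w z : ℂ}

theorem mem_deltaRegion_of_neg_re_le (hθ : 0 < θ) (hθ' : θ < Real.pi / 2) (hne : z ≠ -1)
    (hnorm : ‖z‖ ≤ 1 + η) (hre : -(1 + z).re ≤ Real.cos θ * ‖1 + z‖) :
    z ∈ deltaRegion (-1) η θ \ {-1} := by
  have hpos := norm_one_add_pos hne
  have harg : (z - -1) / -1 = -(1 + z) := by ring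
  refine ⟨⟨by rwa [norm_neg, norm_one], ?_⟩, hne⟩
  rw [harg]
  by_contra! hlt
  have hcos := Real.strictAntiOn_cos ⟨abs_nonneg _, by linarith [Real.pi_pos]⟩
    ⟨hθ.le, by linarith [Real.pi_pos]⟩ hlt
  rw [Real.cos_abs, Complex.cos_arg (neg_ne_zero.mpr (norm_pos_iff.mp hpos)), norm_neg,
    Complex.neg_re, lt_div_iff₀ hpos] at hcos
  linarith

theorem closedBall_diff_subset_deltaRegion (hη : 0 ≤ η) (hθ : 0 < θ) (hθ' : θ < Real.pi / 2) :
    closedBall (0 : ℂ) 1 \ {-1} ⊆ deltaRegion (-1) η θ \ {-1} := by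
  intro z hz
  have hnorm := mem_closedBall_zero_iff.mp hz.1
  have hcos : 0 ≤ Real.cos θ := Real.cos_nonneg_of_mem_Icc ⟨by linarith, hθ'.le⟩
  refine mem_deltaRegion_of_neg_re_le hθ hθ' hz.2 (by linarith) ?_
  linarith [re_one_add_pos hz, mul_nonneg hcos (norm_nonneg (1 + z))]

theorem one_add_mem_slitPlane_of_mem_deltaRegion (hθ : 0 < θ)
    (hz : z ∈ deltaRegion (-1) η θ \ {-1}) : 1 + z ∈ Complex.slitPlane := by
  by_contra! hslit
  obtain ⟨hre, him⟩ : (1 + z).re ≤ 0 ∧ (1 + z).im = 0 := by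
    simpa [Complex.mem_slitPlane_iff] using hslit
  have harg : Complex.arg ((z - -1) / -1) = 0 := by
    rw [show (z - -1) / -1 = -(1 + z) by ring, Complex.arg_eq_zero_iff]
    exact ⟨by rw [Complex.neg_re]; linarith, by rw [Complex.neg_im, him, neg_zero]⟩
  have hle := hz.1.2
  rw [harg, abs_zero] at hle
  exact absurd hle hθ.not_ge

theorem half_norm_one_add_le {c : ℝ} (hc : c ≤ 1 / 2) (hw : w ∈ closedBall z (c * ‖1 + z‖)) :
    ‖1 + z‖ / 2 ≤ ‖1 + w‖ := by
  have hdist : ‖w - z‖ ≤ c * ‖1 + z‖ := by rwa [← dist_eq_norm]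
  have htri := norm_sub_le (1 + w) (w - z)
  rw [show 1 + w - (w - z) = 1 + z by ring] at htri
  nlinarith [norm_nonneg (1 + z)]

theorem norm_one_add_le_two_mul {c : ℝ} (hc : c ≤ 1) (hw : w ∈ closedBall z (c * ‖1 + z‖)) :
    ‖1 + w‖ ≤ 2 * ‖1 + z‖ := by
  have hdist : ‖w - z‖ ≤ c * ‖1 + z‖ := by rwa [← dist_eq_norm]
  have htri := norm_add_le (1 + z) (w - z)
  rw [show 1 + z + (w - z) = 1 + w by ring] at htri
  nlinarith [norm_nonneg (1 + z)]

/-- Points of the unit disk near `-1` see a disk of comparable radius inside the indented disk;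
this is the room needed for Cauchy's estimate. -/
theorem closedBall_subset_deltaRegion (hθ : 0 < θ) (hθ' : θ < Real.pi / 2)
    (hz : z ∈ ball (0 : ℂ) 1) (hzη : ‖1 + z‖ ≤ η) :
    closedBall z (Real.cos θ / 2 * ‖1 + z‖) ⊆ deltaRegion (-1) η θ \ {-1} := by
  intro w hw
  have hz' := ball_subset_closedBall_diff hz
  have hpos := norm_one_add_pos hz'.2
  have hcos : 0 < Real.cos θ := Real.cos_pos_of_mem_Ioo ⟨by linarith, hθ'⟩
  have hdist : ‖w - z‖ ≤ Real.cos θ / 2 * ‖1 + z‖ := by rwa [← dist_eq_norm]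
  have hlower := half_norm_one_add_le (by linarith [Real.cos_le_one θ]) hw
  refine mem_deltaRegion_of_neg_re_le hθ hθ' ?_ ?_ ?_
  · rintro rfl
    norm_num at hlower
    linarith
  · have htri := norm_add_le z (w - z)
    rw [add_sub_cancel] at htri
    nlinarith [mem_ball_zero_iff.mp hz, Real.cos_le_one θ]
  · have hre := (abs_le.mp (Complex.abs_re_le_norm (w - z))).1
    rw [Complex.sub_re] at hre
    have hrez := re_one_add_pos hz'
    rw [Complex.add_re] at hrez ⊢
    nlinarith

theorem deriv_isLittleO_of_closedBall_subset {S T : Set ℂ} {h : ℂ → ℂ} {c : ℝ} (hα : 0 ≤ α)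
    (hc : 0 < c) (hc' : c ≤ 1 / 2) (hh : DifferentiableOn ℂ h S)
    (ho : h =o[𝓝[S] (-1)] fun z => ‖1 + z‖ ^ (-α))
    (hsub : ∀ᶠ z in 𝓝[T] (-1), z ≠ -1 ∧ closedBall z (c * ‖1 + z‖) ⊆ S) :
    deriv h =o[𝓝[T] (-1)] fun z => ‖1 + z‖ ^ (-α - 1) := by
  refine IsLittleO.of_bound fun ε hε => ?_
  obtain ⟨δ, hδ, hnear⟩ := mem_nhdsWithin_iff.mp (ho.def (c := ε * c / 2 ^ α) (by positivity))
  filter_upwards [hsub, mem_nhdsWithin_of_mem_nhds (ball_mem_nhds (-1) (half_pos hδ))]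
    with z ⟨hne, hS⟩ hzδ
  have hpos := norm_one_add_pos hne
  rw [mem_ball, dist_eq_norm, sub_neg_eq_add, add_comm] at hzδ
  have hbound : ∀ w ∈ sphere z (c * ‖1 + z‖), ‖h w‖ ≤ ε * c * ‖1 + z‖ ^ (-α) := by
    intro w hw
    replace hw := sphere_subset_closedBall hw
    have hwδ : w ∈ ball (-1) δ := by
      rw [mem_ball, dist_eq_norm, sub_neg_eq_add, add_comm]
      linarith [norm_one_add_le_two_mul (by linarith) hw]
    have hrpow : ‖1 + w‖ ^ (-α) ≤ 2 ^ α * ‖1 + z‖ ^ (-α) :=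
      calc ‖1 + w‖ ^ (-α) ≤ (‖1 + z‖ / 2) ^ (-α) := Real.rpow_le_rpow_of_nonpos (by positivity)
            (half_norm_one_add_le hc' hw) (neg_nonpos.mpr hα)
        _ = 2 ^ α * ‖1 + z‖ ^ (-α) := by
            rw [Real.div_rpow hpos.le two_pos.le, Real.rpow_neg two_pos.le, div_inv_eq_mul,
              mul_comm]
    calc ‖h w‖ ≤ ε * c / 2 ^ α * ‖‖1 + w‖ ^ (-α)‖ := hnear ⟨hwδ, hS hw⟩
      _ = ε * c / 2 ^ α * ‖1 + w‖ ^ (-α) := by rw [Real.norm_of_nonneg (by positivity)]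
      _ ≤ ε * c / 2 ^ α * (2 ^ α * ‖1 + z‖ ^ (-α)) := by gcongr
      _ = ε * c * ‖1 + z‖ ^ (-α) := by field_simp
  rw [Real.norm_of_nonneg (by positivity), Real.rpow_sub_one hpos.ne']
  calc ‖deriv h z‖ ≤ ε * c * ‖1 + z‖ ^ (-α) / (c * ‖1 + z‖) :=
        Complex.norm_deriv_le_of_forall_mem_sphere_norm_le (by positivity)
          ((hh.mono hS).diffContOnCl_ball subset_rfl) hbound
    _ = ε * (‖1 + z‖ ^ (-α) / ‖1 + z‖) := by field_simp

theorem isLittleO_sub_of_isEquivalent {l : Filter ℂ} {f : ℂ → ℂ} {A : ℂ}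
    (hequiv : f ~[l] fun z => A * (z + 1) ^ (-(α : ℂ))) :
    (fun z => f z - A * (1 + z) ^ (-(α : ℂ))) =o[l] fun z => ‖1 + z‖ ^ (-α) := by
  simp only [add_comm (1 : ℂ), ← norm_cpow_neg_ofReal]
  exact (hequiv.isLittleO.trans_isBigO (isBigO_const_mul_self A _ l)).norm_right

theorem isLowerOrder_of_isEquivalent {f : ℂ → ℂ} {A : ℂ} (hα : 0 ≤ α) (hη : 0 < η) (hθ : 0 < θ)
    (hθ' : θ < Real.pi / 2) (hf : AnalyticOnNhd ℂ f (deltaRegion (-1) η θ \ {-1}))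
    (hequiv : f ~[𝓝[deltaRegion (-1) η θ \ {-1}] (-1)] fun z => A * (z + 1) ^ (-(α : ℂ))) :
    IsLowerOrder α fun z => f z - A * (1 + z) ^ (-(α : ℂ)) := by
  have hsub := closedBall_diff_subset_deltaRegion hη.le hθ hθ'
  have hrem : AnalyticOnNhd ℂ (fun z => f z - A * (1 + z) ^ (-(α : ℂ)))
      (deltaRegion (-1) η θ \ {-1}) := fun z hz =>
    (hf z hz).fun_sub (analyticAt_const.fun_mul ((analyticAt_const.add analyticAt_id).cpow
      analyticAt_const (one_add_mem_slitPlane_of_mem_deltaRegion hθ hz)))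
  have ho := isLittleO_sub_of_isEquivalent hequiv
  refine ⟨hrem.mono hsub, ho.mono (nhdsWithin_mono _ (ball_subset_closedBall_diff.trans hsub)),
    deriv_isLittleO_of_closedBall_subset (c := Real.cos θ / 2) hα
      (half_pos (Real.cos_pos_of_mem_Ioo ⟨by linarith, hθ'⟩)) (by linarith [Real.cos_le_one θ])
      hrem.differentiableOn ho ?_⟩
  filter_upwards [self_mem_nhdsWithin, tendsto_norm_one_add.eventually_le_const hη] with z hz hzη
  exact ⟨(ball_subset_closedBall_diff hz).2, closedBall_subset_deltaRegion hθ hθ' hz hzη⟩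

theorem HasDeltaSingularity.exists_isGenerating {a₀ : ℕ → ℝ} {A : ℝ} (hα : 0 ≤ α)
    (h : HasDeltaSingularity a₀ A α) :
    ∃ f : ℂ → ℂ, IsGenerating a₀ f ∧ IsLowerOrder α fun z => f z - A * (1 + z) ^ (-(α : ℂ)) := by
  obtain ⟨f, η, θ, hη, hθ, hθ', hsum, hf, hequiv⟩ := h
  have hball := ball_subset_closedBall_diff.trans (closedBall_diff_subset_deltaRegion hη.le hθ hθ')
  exact ⟨f, ⟨(hf.mono hball).differentiableOn, taylorCoeff_eq_of_hasSum hsum⟩,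
    isLowerOrder_of_isEquivalent hα hη hθ hθ' hf hequiv⟩

end DeltaRegion

section PowerLaw

variable {a₀ u : ℕ → ℝ} {A α : ℝ}

theorem isEquivalent_const_mul_of_tendsto_div {ι : Type*} {l : Filter ι} {f g : ι → ℝ} {c : ℝ}
    (hc : c ≠ 0) (hg : ∀ᶠ x in l, g x ≠ 0) (h : Tendsto (fun x => f x / g x) l (𝓝 c)) :
    f ~[l] fun x => c * g x :=
  (((isEquivalent_const_iff_tendsto hc).mpr h).mul (IsEquivalent.refl (u := g))).congr_left
    (hg.mono fun _ hx => div_mul_cancel₀ _ hx)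

theorem binomCoeff_isEquivalent (hα : 0 < α) :
    binomCoeff α ~[atTop] fun n : ℕ => (Real.Gamma α)⁻¹ * (n : ℝ) ^ (α - 1) := by
  refine isEquivalent_const_mul_of_tendsto_div (inv_ne_zero (Real.Gamma_pos_of_pos hα).ne') ?_
    (tendsto_binomCoeff hα)
  filter_upwards [eventually_gt_atTop 0] with n hn
  positivity

theorem natCast_succ_rpow_isEquivalent (s : ℝ) :
    (fun n : ℕ => ((n + 1 : ℕ) : ℝ) ^ s) ~[atTop] fun n : ℕ => (n : ℝ) ^ s := by
  have hcast : (fun n : ℕ => ((n + 1 : ℕ) : ℝ)) ~[atTop] fun n : ℕ => (n : ℝ) := by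
    simp only [Nat.cast_add, Nat.cast_one]
    exact IsEquivalent.refl.add_const_of_norm_tendsto_atTop
      (tendsto_norm_atTop_atTop.comp tendsto_natCast_atTop_atTop)
  exact hcast.rpow fun n => n.cast_nonneg

theorem hasAlternatingPowerLaw_iff_succ :
    HasAlternatingPowerLaw u A α ↔
      (fun n => u (n + 1)) ~[atTop] fun n : ℕ =>
        A / Real.Gamma α * ((-1) ^ n * (n : ℝ) ^ (α - 1)) := by
  have hmodel : ((fun n : ℕ => -(A / Real.Gamma α) * (-1) ^ n * (n : ℝ) ^ (α - 1)) ∘ (· + 1))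
      ~[atTop] fun n : ℕ => A / Real.Gamma α * ((-1) ^ n * (n : ℝ) ^ (α - 1)) :=
    (((IsEquivalent.refl (u := fun n : ℕ => A / Real.Gamma α * (-1) ^ n)).mul
      (natCast_succ_rpow_isEquivalent (α - 1))).congr_left (.of_forall fun n => by
        simp only [Pi.mul_apply, Function.comp_apply]; ring)).congr_right
      (.of_forall fun n => mul_assoc _ _ _)
  rw [HasAlternatingPowerLaw]
  nth_rewrite 1 [← map_add_atTop_eq_nat 1]
  rw [isEquivalent_map]
  exact ⟨fun h => h.trans hmodel, fun h => h.trans hmodel.symm⟩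

theorem hasAlternatingPowerLaw_iff_binomCoeff (hα : 0 < α) :
    HasAlternatingPowerLaw u A α ↔
      (fun n => u (n + 1)) ~[atTop] fun n => A * ((-1) ^ n * binomCoeff α n) := by
  have hmodel : (fun n : ℕ => A * ((-1) ^ n * binomCoeff α n)) ~[atTop] fun n : ℕ =>
      A / Real.Gamma α * ((-1) ^ n * (n : ℝ) ^ (α - 1)) :=
    (((IsEquivalent.refl (u := fun n : ℕ => A * (-1) ^ n)).mul
      (binomCoeff_isEquivalent hα)).congr_left (.of_forall fun n => mul_assoc _ _ _)).congr_right
      (.of_forall fun n => by simp only [Pi.mul_apply]; ring)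
  rw [hasAlternatingPowerLaw_iff_succ]
  exact ⟨fun h => h.trans hmodel.symm, fun h => h.trans hmodel⟩

theorem IsLowerOrder.hasAlternatingPowerLaw {f : ℂ → ℂ} (hA : A ≠ 0) (hα : 0 < α)
    (hf : IsLowerOrder α fun z => f z - A * (1 + z) ^ (-(α : ℂ)))
    (hu : ∀ n, taylorCoeff f n = u (n + 1)) : HasAlternatingPowerLaw u A α := by
  have hcoeff (n : ℕ) : u (n + 1) - A * ((-1) ^ n * binomCoeff α n) =
      (taylorCoeff (fun z => f z - A * (1 + z) ^ (-(α : ℂ))) n).re := by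
    have hzero : (0 : ℂ) ∈ closedBall (0 : ℂ) 1 \ {-1} := by simp
    have hadd := taylorCoeff_add (hf.analyticOnNhd 0 hzero)
      ((analyticAt_const (v := (A : ℂ))).fun_mul (analyticOnNhd_one_add_cpow α 0 hzero)) n
    simp only [sub_add_cancel] at hadd
    rw [← Complex.ofReal_re (u (n + 1)), ← hu, hadd, taylorCoeff_const_mul,
      taylorCoeff_one_add_cpow, Complex.add_re]
    norm_cast
    rw [add_sub_cancel_right]
  have hrpow : (fun n : ℕ => (n : ℝ) ^ (α - 1)) =O[atTop] binomCoeff α :=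
    (isBigO_const_mul_left_iff (inv_ne_zero (Real.Gamma_pos_of_pos hα).ne')).mp
      (binomCoeff_isEquivalent hα).isBigO_symm
  have hmodel : binomCoeff α =O[atTop] fun n => A * ((-1) ^ n * binomCoeff α n) :=
    .of_bound ‖A‖⁻¹ (.of_forall fun n => by simp [hA])
  rw [hasAlternatingPowerLaw_iff_binomCoeff hα]
  refine IsLittleO.isEquivalent ((IsBigO.of_bound 1 (.of_forall fun n => ?_)).trans_isLittleO
    ((hf.taylorCoeff_isLittleO hα).trans_isBigO (hrpow.trans hmodel)))
  rw [Pi.sub_apply, hcoeff, one_mul]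
  exact Complex.abs_re_le_norm _

theorem HasDeltaSingularity.hasAlternatingPowerLaw (hA : A ≠ 0) (hα : 0 < α)
    (h : HasDeltaSingularity a₀ A α) : HasAlternatingPowerLaw a₀ A α := by
  obtain ⟨f, hgen, hf⟩ := h.exists_isGenerating hα.le
  exact hf.hasAlternatingPowerLaw hA hα hgen.taylorCoeff_eq

theorem IsSolution.hasAlternatingPowerLaw {a : ℕ → ℝ → ℝ} {t : ℝ} (hA : A ≠ 0) (hα : 0 < α)
    (ha : IsSolution a₀ a) (h : HasDeltaSingularity a₀ A α) (ht : 0 ≤ t) :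
    HasAlternatingPowerLaw (fun n => a n t) (A * Real.exp ((2 * α - 1) * t)) α := by
  obtain ⟨f, hgen, hf⟩ := h.exists_isGenerating hα.le
  exact (hf.evolve_sub t).hasAlternatingPowerLaw (mul_ne_zero hA (Real.exp_ne_zero _)) hα
    (ha.taylorCoeff_evolve_eq hgen ht)

end PowerLaw

section Abelian

variable {α : ℝ}

theorem hasSum_binomCoeff_real (α : ℝ) {x : ℝ} (hx : 0 ≤ x) (hx1 : x < 1) :
    HasSum (fun n : ℕ => binomCoeff α n * x ^ n) ((1 - x) ^ (-α)) := by
  have hsum := hasSum_binomCoeff α (z := x) (by rwa [Complex.norm_real, Real.norm_of_nonneg hx])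
  have hcast : (1 - (x : ℂ)) ^ (-(α : ℂ)) = (((1 - x) ^ (-α) : ℝ) : ℂ) := by
    rw [Complex.ofReal_cpow (by linarith)]
    push_cast
    rfl
  rw [hcast] at hsum
  exact_mod_cast hsum

theorem exists_taylorCoeff_eq_of_summable {c : ℕ → ℂ}
    (hc : ∀ r : ℝ, 0 ≤ r → r < 1 → Summable fun n => ‖c n‖ * r ^ n) :
    ∃ f : ℂ → ℂ, DifferentiableOn ℂ f (ball 0 1) ∧ ∀ n, taylorCoeff f n = c n := by
  have hbound (r : ℝ) (n : ℕ) (z : ℂ) (hz : z ∈ ball (0 : ℂ) r) :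
      ‖c n * z ^ n‖ ≤ ‖c n‖ * r ^ n := by
    rw [norm_mul, norm_pow]
    gcongr
    exact (mem_ball_zero_iff.mp hz).le
  refine ⟨fun z => ∑' n, c n * z ^ n, fun z hz => ?_, taylorCoeff_eq_of_hasSum ?_⟩
  · obtain ⟨r, hzr, hr⟩ := exists_between (mem_ball_zero_iff.mp hz)
    have hdiff := Complex.differentiableOn_tsum_of_summable_norm
      (F := fun n z => c n * z ^ n) (U := ball 0 r) (hc r ((norm_nonneg z).trans hzr.le) hr)
      (fun n => ((differentiable_id.pow n).const_mul _).differentiableOn) isOpen_ball (hbound r)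
    exact (hdiff.differentiableAt
      (isOpen_ball.mem_nhds (mem_ball_zero_iff.mpr hzr))).differentiableWithinAt
  · filter_upwards [ball_mem_nhds (0 : ℂ) (by norm_num : (0 : ℝ) < 1 / 2)] with z hz
    exact (Summable.of_norm_bounded (hc (1 / 2) (by norm_num) (by norm_num))
      fun n => hbound _ n z hz).hasSum

theorem HasAlternatingPowerLaw.exists_isGenerating {A : ℝ} {a₀ : ℕ → ℝ} (hα : 0 < α)
    (h : HasAlternatingPowerLaw a₀ A α) : ∃ f : ℂ → ℂ, IsGenerating a₀ f := by
  have hbigO : (fun n => a₀ (n + 1)) =O[atTop] binomCoeff α :=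
    ((hasAlternatingPowerLaw_iff_binomCoeff hα).mp h).isBigO.trans
      (.of_bound ‖A‖ (.of_forall fun n => by simp))
  obtain ⟨f, hf, hcoeff⟩ := exists_taylorCoeff_eq_of_summable (c := fun n => a₀ (n + 1))
    fun r hr hr1 => summable_of_isBigO_nat (hasSum_binomCoeff_real α hr hr1).summable
      (IsBigO.mul (by simpa using hbigO) (isBigO_refl _ _))
  exact ⟨f, hf, hcoeff⟩

theorem exists_norm_le_of_taylorCoeff_isLittleO {g : ℂ → ℂ} {ε : ℝ} (hα : 0 < α)
    (hg : DifferentiableOn ℂ g (ball 0 1)) (hsmall : taylorCoeff g =o[atTop] binomCoeff α)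
    (hε : 0 < ε) : ∃ C, ∀ z ∈ ball (0 : ℂ) 1, ‖g z‖ ≤ ε * (1 - ‖z‖) ^ (-α) + C := by
  set excess : ℕ → ℝ := fun n => max (‖taylorCoeff g n‖ - ε * binomCoeff α n) 0
  have hexcess : Summable excess := by
    refine summable_zero.congr_cofinite ?_
    rw [Nat.cofinite_eq_atTop]
    filter_upwards [hsmall.def hε] with n hn
    rw [Real.norm_of_nonneg (binomCoeff_pos hα n).le] at hn
    exact (max_eq_right (sub_nonpos.mpr hn)).symm
  refine ⟨∑' n, excess n, fun z hz => ?_⟩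
  have hz1 := mem_ball_zero_iff.mp hz
  rw [← (hasSum_taylorCoeff hg hz).tsum_eq]
  refine tsum_of_norm_bounded
    (((hasSum_binomCoeff_real α (norm_nonneg z) hz1).mul_left ε).add hexcess.hasSum) fun n => ?_
  calc ‖taylorCoeff g n * z ^ n‖
      = (‖taylorCoeff g n‖ - ε * binomCoeff α n) * ‖z‖ ^ n +
          ε * (binomCoeff α n * ‖z‖ ^ n) := by
        rw [norm_mul, norm_pow]
        ring
    _ ≤ excess n * 1 + ε * (binomCoeff α n * ‖z‖ ^ n) := by
        gcongr ?_ + _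
        exact mul_le_mul (le_max_left _ _) (pow_le_one₀ (norm_nonneg z) hz1.le)
          (by positivity) (le_max_right _ _)
    _ = _ := by ring

theorem HasAlternatingPowerLaw.taylorCoeff_sub_isLittleO {A : ℝ} {a₀ : ℕ → ℝ} {f : ℂ → ℂ}
    (hα : 0 < α) (h : HasAlternatingPowerLaw a₀ A α) (hf : IsGenerating a₀ f) :
    taylorCoeff (fun z => f z - A * (1 + z) ^ (-(α : ℂ))) =o[atTop] binomCoeff α := by
  have hcoeff (n : ℕ) : taylorCoeff (fun z => f z - A * (1 + z) ^ (-(α : ℂ))) n =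
      (a₀ (n + 1) - A * ((-1) ^ n * binomCoeff α n) : ℝ) := by
    rw [taylorCoeff_sub (analyticAt_zero_of_differentiableOn_ball one_pos hf.differentiableOn)
      (analyticAt_const.fun_mul (analyticOnNhd_one_add_cpow α 0 (by simp))), hf.taylorCoeff_eq,
      taylorCoeff_const_mul, taylorCoeff_one_add_cpow]
    push_cast
    rfl
  have hsmall := ((hasAlternatingPowerLaw_iff_binomCoeff hα).mp h).isLittleO.trans_isBigO
    (.of_bound ‖A‖ (.of_forall fun n => by simp) : _ =O[atTop] binomCoeff α)
  refine (IsBigO.of_bound 1 (.of_forall fun n => ?_)).trans_isLittleO hsmall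
  rw [hcoeff, Complex.norm_real, one_mul, Pi.sub_apply]

end Abelian

section LongTime

variable {A C ε α t : ℝ} {f h : ℂ → ℂ} {z : ℂ}

/-- The limit shape of the rescaled generating function `e^{-(2α-1)t} G(z, t)` as `t → ∞`, up to the
factor `A`. -/
noncomputable def limitShape (α : ℝ) (z : ℂ) : ℂ :=
  ((1 - z) / 2) ^ ((α : ℂ) - 1) * (1 + z) ^ (-(α : ℂ))

theorem re_one_sub_div_two_pos (hz : ‖z‖ < 1) : 0 < ((1 - z) / 2).re := by
  have hre := (Complex.re_le_norm z).trans_lt hz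
  rw [← Complex.ofReal_ofNat, Complex.div_ofReal_re, Complex.sub_re, Complex.one_re]
  linarith

theorem differentiableOn_limitShape (α : ℝ) : DifferentiableOn ℂ (limitShape α) (ball 0 1) :=
  fun z hz => (DifferentiableAt.mul
    (DifferentiableAt.cpow (f := fun z : ℂ => (1 - z) / 2) (by fun_prop) (by fun_prop)
      (Or.inl (re_one_sub_div_two_pos (mem_ball_zero_iff.mp hz))))
    (hasDerivAt_one_add_cpow α
      (re_one_add_pos (ball_subset_closedBall_diff hz))).differentiableAt).differentiableWithinAt

theorem limitShape_ofReal {x : ℝ} (hx : |x| < 1) :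
    limitShape α x = ((1 / 2) ^ (α - 1) * (1 / (1 - x) * ((1 - x) / (1 + x)) ^ α) : ℝ) := by
  have hsub : 0 < 1 - x := by linarith [(abs_lt.mp hx).2]
  have hadd : 0 < 1 + x := by linarith [(abs_lt.mp hx).1]
  have hreal : (1 / 2) ^ (α - 1) * (1 / (1 - x) * ((1 - x) / (1 + x)) ^ α) =
      ((1 - x) / 2) ^ (α - 1) * (1 + x) ^ (-α) := by
    rw [Real.div_rpow hsub.le hadd.le, Real.rpow_neg hadd.le, div_eq_mul_one_div (1 - x) 2,
      Real.mul_rpow hsub.le (by norm_num), Real.rpow_sub_one hsub.ne']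
    ring
  rw [hreal, limitShape]
  push_cast [Complex.ofReal_cpow (div_pos hsub two_pos).le, Complex.ofReal_cpow hadd.le]
  rfl

theorem re_taylorCoeff_limitShape (α : ℝ) (n : ℕ) :
    (taylorCoeff (limitShape α) n).re = 2 ^ (1 - α) * taylorC α n := by
  have hpow : (2 : ℝ) ^ (1 - α) = (1 / 2) ^ (α - 1) := by
    rw [one_div, Real.inv_rpow two_pos.le, ← Real.rpow_neg two_pos.le, neg_sub]
  change _ = 2 ^ (1 - α) * taylorCoeff (fun x : ℝ => 1 / (1 - x) * ((1 - x) / (1 + x)) ^ α) n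
  rw [hpow, ← taylorCoeff_const_mul]
  refine (taylorCoeff_eq_of_hasSum (c := fun n => (taylorCoeff (limitShape α) n).re) ?_ n).symm
  filter_upwards [ball_mem_nhds (0 : ℝ) one_pos] with x hx
  rw [mem_ball_zero_iff] at hx
  have hsum := Complex.hasSum_re (hasSum_taylorCoeff (differentiableOn_limitShape α)
    (z := x) (by rwa [mem_ball_zero_iff, Complex.norm_real]))
  rw [limitShape_ofReal hx, Complex.ofReal_re] at hsum
  simpa only [← Complex.ofReal_pow, Complex.re_mul_ofReal] using hsum

/-- The denominator of the flow with its exponential growth in time divided out. -/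
noncomputable def rescaledDen (t : ℝ) (z : ℂ) : ℂ := Real.exp (-t) * flowDen t z

theorem rescaledDen_eq (t : ℝ) (z : ℂ) :
    rescaledDen t z = ((1 + Real.exp (-(2 * t))) / 2 : ℝ) -
      ((1 - Real.exp (-(2 * t))) / 2 : ℝ) * z := by
  have hsq : Real.exp (-(2 * t)) = Real.exp (-t) * Real.exp (-t) := by
    rw [← Real.exp_add]
    ring_nf
  have hinv : (Real.exp t : ℂ) * Real.exp (-t) = 1 := by
    rw [← Complex.ofReal_mul, ← Real.exp_add, add_neg_cancel, Real.exp_zero, Complex.ofReal_one]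
  rw [rescaledDen, flowDen, Real.cosh_eq, Real.sinh_eq, hsq]
  push_cast at hinv ⊢
  linear_combination ((1 - z) / 2) * hinv

theorem tendsto_exp_neg_mul_atTop {c : ℝ} (hc : 0 < c) :
    Tendsto (fun t : ℝ => Real.exp (-(c * t))) atTop (𝓝 0) :=
  Real.tendsto_exp_neg_atTop_nhds_zero.comp (tendsto_id.const_mul_atTop hc)

theorem tendsto_rescaledDen (z : ℂ) :
    Tendsto (fun t => rescaledDen t z) atTop (𝓝 ((1 - z) / 2)) := by
  have hexp := tendsto_exp_neg_mul_atTop two_pos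
  have hlim := ((Complex.continuous_ofReal.tendsto _).comp
    ((hexp.const_add 1).div_const 2)).sub (((Complex.continuous_ofReal.tendsto _).comp
      ((hexp.const_sub 1).div_const 2)).mul_const z)
  have hvalue : (((1 + 0) / 2 : ℝ) : ℂ) - ((1 - 0) / 2 : ℝ) * z = (1 - z) / 2 := by
    push_cast
    ring
  rw [hvalue] at hlim
  exact hlim.congr fun t => (rescaledDen_eq t z).symm

theorem norm_rescaledDen_mem_Icc (ht : 0 ≤ t) (hz : ‖z‖ = 1 / 2) :
    ‖rescaledDen t z‖ ∈ Set.Icc (1 / 4) 1 := by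
  have hpos := Real.exp_pos (-(2 * t))
  have hle : Real.exp (-(2 * t)) ≤ 1 := Real.exp_le_one_iff.mpr (by linarith)
  rw [rescaledDen_eq]
  set q := Real.exp (-(2 * t))
  have hconst : ‖(((1 + q) / 2 : ℝ) : ℂ)‖ = (1 + q) / 2 := by
    rw [Complex.norm_real, Real.norm_of_nonneg (by positivity)]
  have hlinear : ‖(((1 - q) / 2 : ℝ) : ℂ) * z‖ = (1 - q) / 4 := by
    rw [norm_mul, Complex.norm_real, Real.norm_of_nonneg (by linarith), hz]
    ring
  have hlower := norm_sub_norm_le (((1 + q) / 2 : ℝ) : ℂ) (((1 - q) / 2 : ℝ) * z)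
  have hupper := norm_sub_le (((1 + q) / 2 : ℝ) : ℂ) (((1 - q) / 2 : ℝ) * z)
  rw [hconst, hlinear] at hlower hupper
  exact ⟨by linarith, by linarith⟩

theorem norm_flowDen_eq (t : ℝ) (z : ℂ) : ‖flowDen t z‖ = Real.exp t * ‖rescaledDen t z‖ := by
  rw [rescaledDen, norm_mul, Complex.norm_real, Real.norm_of_nonneg (Real.exp_pos _).le,
    ← mul_assoc, ← Real.exp_add, add_neg_cancel, Real.exp_zero, one_mul]

theorem exp_neg_le_one_sub_norm_flow (ht : 0 ≤ t) (hz : ‖z‖ = 1 / 2) :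
    3 / 8 * Real.exp (-(2 * t)) ≤ 1 - ‖flow t z‖ := by
  have hz1 : ‖z‖ < 1 := by rw [hz]; norm_num
  have hden := flowDen_ne_zero t hz1.le
  have hsq : 3 / 4 * Real.exp (-(2 * t)) ≤ 1 - ‖flow t z‖ ^ 2 := by
    have hexp : Real.exp (-(2 * t)) * Real.exp t ^ 2 = 1 := by
      rw [← Real.exp_nat_mul, ← Real.exp_add]
      simp
    rw [one_sub_norm_flow_sq hden, hz, le_div_iff₀ (by positivity), norm_flowDen_eq, mul_pow]
    have hle := pow_le_one₀ (n := 2) (norm_nonneg _) (norm_rescaledDen_mem_Icc ht hz).2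
    linear_combination 3 / 4 * ‖rescaledDen t z‖ ^ 2 * hexp + 3 / 4 * hle
  nlinarith [norm_nonneg (flow t z), norm_flow_lt_one t hz1]

theorem rescaled_evolve_eq (A α t : ℝ) (f : ℂ → ℂ) (hz : ‖z‖ < 1) :
    Real.exp (-((2 * α - 1) * t)) * evolve f t z =
      A * (rescaledDen t z ^ ((α : ℂ) - 1) * (1 + z) ^ (-(α : ℂ))) +
      Real.exp (-(2 * α * t)) * (rescaledDen t z)⁻¹ *
        (f (flow t z) - A * (1 + flow t z) ^ (-(α : ℂ))) := by
  have hne := flowDen_ne_zero t hz.le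
  have hcpow : rescaledDen t z ^ ((α : ℂ) - 1) =
      Real.exp ((1 - α) * t) * flowDen t z ^ ((α : ℂ) - 1) := by
    have hexp : (Real.exp (-t) : ℂ) ≠ 0 := mod_cast (Real.exp_pos _).ne'
    rw [rescaledDen, Complex.cpow_def_of_ne_zero (mul_ne_zero hexp hne),
      Complex.cpow_def_of_ne_zero hne, Complex.log_ofReal_mul (Real.exp_pos _) hne, Real.log_exp,
      Complex.ofReal_exp, ← Complex.exp_add]
    push_cast
    ring_nf
  have hmain : Real.exp (-((2 * α - 1) * t)) * Real.exp (α * t) = Real.exp ((1 - α) * t) := by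
    rw [← Real.exp_add]
    ring_nf
  have hremainder :
      Real.exp (-((2 * α - 1) * t)) = Real.exp (-(2 * α * t)) * (Real.exp (-t))⁻¹ := by
    rw [← Real.exp_neg, ← Real.exp_add]
    ring_nf
  rw [evolve_eq_add A α f (re_one_add_pos (ball_subset_closedBall_diff (mem_ball_zero_iff.mpr hz)))
    (re_flowDen_pos t hz.le), hcpow, ← hmain, mul_add, hremainder, rescaledDen]
  push_cast
  ring

theorem norm_rescaled_remainder_le (hα : 0 ≤ α) (hε : 0 ≤ ε)
    (hh : ∀ w ∈ ball (0 : ℂ) 1, ‖h w‖ ≤ ε * (1 - ‖w‖) ^ (-α) + C) (ht : 0 ≤ t)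
    (hz : ‖z‖ = 1 / 2) :
    ‖Real.exp (-(2 * α * t)) * (rescaledDen t z)⁻¹ * h (flow t z)‖ ≤
      4 * (ε * (3 / 8) ^ (-α) + C * Real.exp (-(2 * α * t))) := by
  have hz1 : ‖z‖ < 1 := by rw [hz]; norm_num
  have hden := (norm_rescaledDen_mem_Icc ht hz).1
  have hrpow : (1 - ‖flow t z‖) ^ (-α) ≤ (3 / 8) ^ (-α) * Real.exp (2 * α * t) := by
    refine (Real.rpow_le_rpow_of_nonpos (by positivity) (exp_neg_le_one_sub_norm_flow ht hz)
      (neg_nonpos.mpr hα)).trans_eq ?_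
    rw [Real.mul_rpow (by norm_num) (Real.exp_pos _).le, ← Real.exp_mul]
    ring_nf
  have hbound : ‖h (flow t z)‖ ≤ ε * ((3 / 8) ^ (-α) * Real.exp (2 * α * t)) + C :=
    (hh _ (mapsTo_flow_ball t (mem_ball_zero_iff.mpr hz1))).trans (by gcongr)
  have hexp : Real.exp (-(2 * α * t)) * Real.exp (2 * α * t) = 1 := by
    rw [← Real.exp_add, neg_add_cancel, Real.exp_zero]
  rw [norm_mul, norm_mul, Complex.norm_real, Real.norm_of_nonneg (Real.exp_pos _).le, norm_inv]
  calc Real.exp (-(2 * α * t)) * ‖rescaledDen t z‖⁻¹ * ‖h (flow t z)‖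
      ≤ Real.exp (-(2 * α * t)) * (1 / 4)⁻¹ *
          (ε * ((3 / 8) ^ (-α) * Real.exp (2 * α * t)) + C) := by gcongr
    _ = _ := by linear_combination 4 * ε * (3 / 8) ^ (-α) * hexp

theorem tendsto_rescaled_remainder (hα : 0 < α)
    (hh : ∀ ε > 0, ∃ C, ∀ w ∈ ball (0 : ℂ) 1, ‖h w‖ ≤ ε * (1 - ‖w‖) ^ (-α) + C)
    (hz : ‖z‖ = 1 / 2) :
    Tendsto (fun t => Real.exp (-(2 * α * t)) * (rescaledDen t z)⁻¹ * h (flow t z)) atTop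
      (𝓝 0) := by
  rw [tendsto_zero_iff_norm_tendsto_zero, Metric.tendsto_nhds]
  intro δ hδ
  obtain ⟨C, hC⟩ := hh (δ / (8 * (3 / 8) ^ (-α))) (by positivity)
  have hlim : Tendsto (fun t => 4 * (C * Real.exp (-(2 * α * t)))) atTop (𝓝 0) := by
    simpa using ((tendsto_exp_neg_mul_atTop (mul_pos two_pos hα)).const_mul C).const_mul 4
  filter_upwards [hlim.eventually_lt_const (half_pos hδ), eventually_ge_atTop 0] with t hsmall ht
  rw [dist_zero_right, norm_norm]
  refine (norm_rescaled_remainder_le hα.le (by positivity) hC ht hz).trans_lt ?_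
  have hhalf : 4 * (δ / (8 * (3 / 8) ^ (-α)) * (3 / 8 : ℝ) ^ (-α)) = δ / 2 := by
    field_simp
    norm_num
  linarith

theorem tendsto_rescaled_evolve (hα : 0 < α)
    (hh : ∀ ε > 0, ∃ C, ∀ w ∈ ball (0 : ℂ) 1,
      ‖f w - A * (1 + w) ^ (-(α : ℂ))‖ ≤ ε * (1 - ‖w‖) ^ (-α) + C) (hz : ‖z‖ = 1 / 2) :
    Tendsto (fun t => Real.exp (-((2 * α - 1) * t)) * evolve f t z) atTop
      (𝓝 (A * limitShape α z)) := by
  have hz1 : ‖z‖ < 1 := by rw [hz]; norm_num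
  have hpow := (continuousAt_cpow_const (b := (α : ℂ) - 1)
    (Or.inl (re_one_sub_div_two_pos hz1))).tendsto.comp (tendsto_rescaledDen z)
  simpa only [rescaled_evolve_eq A α _ f hz1, add_zero, limitShape, Function.comp_apply] using
    ((hpow.mul_const _).const_mul _).add (tendsto_rescaled_remainder hα hh hz)

theorem exists_norm_rescaled_evolve_le {ε : ℝ} (hα : 0 < α) (hε : 0 ≤ ε)
    (hh : ∃ C, ∀ w ∈ ball (0 : ℂ) 1,
      ‖f w - A * (1 + w) ^ (-(α : ℂ))‖ ≤ ε * (1 - ‖w‖) ^ (-α) + C) :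
    ∃ M, ∀ t : ℝ, 0 ≤ t → ∀ z ∈ sphere (0 : ℂ) (1 / 2),
      ‖Real.exp (-((2 * α - 1) * t)) * evolve f t z‖ ≤ M := by
  obtain ⟨C, hC⟩ := hh
  obtain ⟨M₁, hM₁⟩ := (isCompact_Icc (a := (1 / 4 : ℝ)) (b := 1)).exists_bound_of_continuousOn
    (f := fun x => x ^ (α - 1))
    (continuousOn_id.rpow_const fun x hx => Or.inl (by linarith [hx.1] : (0 : ℝ) < x).ne')
  have hball : sphere (0 : ℂ) (1 / 2) ⊆ ball 0 1 :=
    sphere_subset_closedBall.trans (closedBall_subset_ball (by norm_num))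
  obtain ⟨M₂, hM₂⟩ := (isCompact_sphere (0 : ℂ) (1 / 2)).exists_bound_of_continuousOn
    fun z hz => (hasDerivAt_one_add_cpow α
      (re_one_add_pos (ball_subset_closedBall_diff (hball hz)))).continuousAt.continuousWithinAt
  refine ⟨|A| * (M₁ * M₂) + 4 * (ε * (3 / 8) ^ (-α) + |C| * 1), fun t ht z hz => ?_⟩
  have hz' := mem_sphere_zero_iff_norm.mp hz
  have hden := hM₁ _ (norm_rescaledDen_mem_Icc ht hz')
  have hcast : (α : ℂ) - 1 = ((α - 1 : ℝ) : ℂ) := by push_cast; rfl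
  rw [Real.norm_of_nonneg (by positivity), ← Complex.norm_cpow_real, ← hcast] at hden
  rw [rescaled_evolve_eq A α t f (mem_ball_zero_iff.mp (hball hz))]
  refine (norm_add_le _ _).trans (add_le_add ?_
    ((norm_rescaled_remainder_le hα.le hε hC ht hz').trans ?_))
  · rw [norm_mul, norm_mul, Complex.norm_real, Real.norm_eq_abs]
    gcongr
    · exact (norm_nonneg _).trans hden
    · exact hM₂ z hz
  · gcongr
    · exact le_abs_self C
    · exact Real.exp_le_one_iff.mpr (neg_nonpos.mpr (by positivity))

theorem IsSolution.tendsto_div_exp {a₀ : ℕ → ℝ} {a : ℕ → ℝ → ℝ} (hα : 0 < α)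
    (ha : IsSolution a₀ a) (h : HasAlternatingPowerLaw a₀ A α) (m : ℕ) :
    Tendsto (fun t => a (m + 1) t / Real.exp ((2 * α - 1) * t)) atTop
      (𝓝 (2 ^ (1 - α) * A * taylorC α m)) := by
  obtain ⟨f, hf⟩ := h.exists_isGenerating hα
  have hdiff : DifferentiableOn ℂ (fun z => f z - A * (1 + z) ^ (-(α : ℂ))) (ball 0 1) :=
    hf.differentiableOn.sub fun z hz => ((hasDerivAt_one_add_cpow α (re_one_add_pos
      (ball_subset_closedBall_diff hz))).const_mul _).differentiableAt.differentiableWithinAt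
  have hbound (ε : ℝ) (hε : 0 < ε) := exists_norm_le_of_taylorCoeff_isLittleO hα hdiff
    (h.taylorCoeff_sub_isLittleO hα hf) hε
  obtain ⟨M, hM⟩ := exists_norm_rescaled_evolve_le hα zero_le_one (hbound 1 one_pos)
  have hclosed : closedBall (0 : ℂ) (1 / 2) ⊆ ball 0 1 := closedBall_subset_ball (by norm_num)
  have hlim := tendsto_taylorCoeff_of_bounded (l := atTop) (R := 1 / 2) (by norm_num)
    (fun t => ((differentiableOn_evolve_ball hf.differentiableOn t).const_mul
      (Real.exp (-((2 * α - 1) * t)) : ℂ)).diffContOnCl_ball hclosed)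
    (((differentiableOn_limitShape α).const_mul (A : ℂ)).diffContOnCl_ball hclosed)
    ((eventually_ge_atTop 0).mono hM)
    (fun z hz => tendsto_rescaled_evolve hα hbound (mem_sphere_zero_iff_norm.mp hz)) m
  simp only [taylorCoeff_const_mul] at hlim
  have hre := (Complex.continuous_re.tendsto _).comp hlim
  simp only [Function.comp_def, Complex.re_ofReal_mul, re_taylorCoeff_limitShape, Real.exp_neg,
    ← div_eq_inv_mul] at hre
  rw [mul_left_comm, ← mul_assoc] at hre
  refine hre.congr' ?_
  filter_upwards [eventually_ge_atTop 0] with t ht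
  rw [ha.taylorCoeff_evolve_eq hf ht, Complex.ofReal_re]

end LongTime

section Energy

section TsumEnorm

variable {E : Type*} [NormedAddCommGroup E] {u : ℕ → E}

theorem toReal_tsum_enorm_sq (u : ℕ → E) : (∑' n, ‖u n‖ₑ ^ 2).toReal = ∑' n, ‖u n‖ ^ 2 := by
  rw [ENNReal.tsum_toReal_eq fun n => ENNReal.pow_ne_top enorm_ne_top]
  simp

theorem tsum_enorm_sq_ne_top_iff : ∑' n, ‖u n‖ₑ ^ 2 ≠ ⊤ ↔ Summable fun n => ‖u n‖ ^ 2 := by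
  refine ⟨fun h => by simpa using ENNReal.summable_toReal h, fun h => ?_⟩
  convert h.tsum_ofReal_ne_top using 4 with n
  rw [ENNReal.ofReal_pow (norm_nonneg _), ofReal_norm]

theorem summable_norm_sq_of_norm_le {C q : ℝ} (hq : 0 ≤ q) (hq1 : q < 1)
    (h : ∀ n, ‖u n‖ ≤ C * q ^ n) : Summable fun n => ‖u n‖ ^ 2 := by
  refine Summable.of_nonneg_of_le (fun n => sq_nonneg _) (fun n => ?_)
    ((summable_geometric_of_lt_one (sq_nonneg q) (pow_lt_one₀ hq hq1 two_ne_zero)).mul_left (C ^ 2))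
  rw [← pow_mul, mul_comm 2 n, pow_mul, ← mul_pow]
  exact pow_le_pow_left₀ (norm_nonneg _) (h n) 2

end TsumEnorm

theorem SolvesShellSystem.tsum_norm_sq_eq {E : Type*} [NormedAddCommGroup E]
    [InnerProductSpace ℝ E] {u : ℕ → ℝ → E} {s : Set ℝ} {C q a t : ℝ} (hs : Convex ℝ s)
    (hu : SolvesShellSystem u s) (hq : 0 ≤ q) (hq1 : q < 1)
    (hbound : ∀ x ∈ s, ∀ n, ‖u n x‖ ≤ C * q ^ n) (ha : a ∈ s) (ht : t ∈ s) :
    ∑' n, ‖u n t‖ ^ 2 = ∑' n, ‖u n a‖ ^ 2 := by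
  have hC : 0 ≤ C := by simpa using (norm_nonneg _).trans (hbound a ha 0)
  have hrate (N : ℕ) (x : ℝ) (hx : x ∈ s) :
      ‖-2 * N * inner ℝ (u (N - 1) x) (u N x)‖ ≤ 2 * C ^ 2 * (N * q ^ N) := by
    have hprev : ‖u (N - 1) x‖ ≤ C :=
      (hbound x hx _).trans (mul_le_of_le_one_right hC (pow_le_one₀ hq hq1.le))
    calc ‖-2 * N * inner ℝ (u (N - 1) x) (u N x)‖
        ≤ 2 * N * (‖u (N - 1) x‖ * ‖u N x‖) := by
          rw [norm_mul, norm_mul, norm_neg, Real.norm_two, Real.norm_natCast]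
          gcongr
          exact norm_inner_le_norm _ _
      _ ≤ 2 * N * (C * (C * q ^ N)) := by
          gcongr
          exact hbound x hx N
      _ = 2 * C ^ 2 * (N * q ^ N) := by ring
  have hdiff (N : ℕ) : ‖∑ n ∈ Finset.range N, ‖u n t‖ ^ 2 - ∑ n ∈ Finset.range N, ‖u n a‖ ^ 2‖ ≤
      2 * C ^ 2 * (N * q ^ N) * ‖t - a‖ :=
    hs.norm_image_sub_le_of_norm_hasDerivWithin_le (fun x hx => hu.hasDerivWithinAt_energy hx N)
      (hrate N) ha ht
  have hzero : Tendsto (fun N : ℕ => 2 * C ^ 2 * (N * q ^ N) * ‖t - a‖) atTop (𝓝 0) := by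
    simpa using ((tendsto_self_mul_const_pow_of_lt_one hq hq1).const_mul (2 * C ^ 2)).mul_const _
  have hsum (x : ℝ) (hx : x ∈ s) := (summable_norm_sq_of_norm_le hq hq1
    (hbound x hx)).hasSum.tendsto_sum_nat
  exact sub_eq_zero.mp (tendsto_nhds_unique ((hsum t ht).sub (hsum a ha))
    (squeeze_zero_norm hdiff hzero))

section HardyEnergy

/-- The squared Hardy norm of `f`, which is the energy of the sequence generated by `f`. -/
noncomputable def hardyEnergy (f : ℂ → ℂ) : ENNReal := ∑' n, ‖taylorCoeff f n‖ₑ ^ 2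

variable {f : ℂ → ℂ} {r R : ℝ}

theorem exists_one_lt_flow_mem_ball {K : Set ℝ} (hK : IsCompact K) (hR : 1 < R) :
    ∃ r, 1 < r ∧ ∀ t ∈ K, ∀ z ∈ ball (0 : ℂ) r, flowDen t z ≠ 0 ∧ flow t z ∈ ball (0 : ℂ) R := by
  have hden : IsOpen {p : ℝ × ℂ | flowDen p.1 p.2 ≠ 0} :=
    isOpen_ne_fun continuous_flowDen continuous_const
  have hopen := continuousOn_flow.isOpen_inter_preimage hden (isOpen_ball (x := (0 : ℂ)) (ε := R))
  obtain ⟨V, W, -, hW, hKV, hballW, hsub⟩ := generalized_tube_lemma hK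
    (isCompact_closedBall (0 : ℂ) 1) hopen fun p hp =>
      have hz := mem_closedBall_zero_iff.mp hp.2
      ⟨flowDen_ne_zero p.1 hz, mem_ball_zero_iff.mpr ((norm_flow_le_one p.1 hz).trans_lt hR)⟩
  obtain ⟨δ, hδ, hδW⟩ := (isCompact_closedBall (0 : ℂ) 1).exists_thickening_subset_open hW hballW
  rw [thickening_closedBall hδ zero_le_one] at hδW
  exact ⟨δ + 1, by linarith, fun t ht z hz => hsub (Set.mk_mem_prod (hKV ht) (hδW hz))⟩

theorem exists_norm_taylorCoeff_evolve_le {K : Set ℝ} (hK : IsCompact K) (hR : 1 < R)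
    (hf : DifferentiableOn ℂ f (ball 0 R)) :
    ∃ C q : ℝ, 0 ≤ q ∧ q < 1 ∧ ∀ t ∈ K, ∀ n, ‖taylorCoeff (evolve f t) n‖ ≤ C * q ^ n := by
  obtain ⟨r, hr, hmem⟩ := exists_one_lt_flow_mem_ball hK hR
  obtain ⟨ρ, hρ, hρr⟩ := exists_between hr
  have hsub : closedBall (0 : ℂ) ρ ⊆ ball 0 r := closedBall_subset_ball hρr
  obtain ⟨C, hC⟩ := exists_norm_taylorCoeff_le_of_isCompact (F := evolve f) hK
    (one_pos.trans hρ)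
    (fun t ht => (differentiableOn_evolve hf (fun z hz => (hmem t ht z hz).1)
      fun z hz => (hmem t ht z hz).2).diffContOnCl_ball hsub)
    (continuousOn_evolve hf.continuousOn
      (fun p hp => (hmem p.1 hp.1 p.2 (hsub (sphere_subset_closedBall hp.2))).1)
      fun p hp => (hmem p.1 hp.1 p.2 (hsub (sphere_subset_closedBall hp.2))).2)
  exact ⟨C, ρ⁻¹, by positivity, inv_lt_one_of_one_lt₀ hρ, fun t ht n => by
    simpa [div_eq_mul_inv] using hC t ht n⟩

theorem hardyEnergy_evolve_of_one_lt (hR : 1 < R) (hf : DifferentiableOn ℂ f (ball 0 R)) (t : ℝ) :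
    hardyEnergy (evolve f t) = hardyEnergy f := by
  obtain ⟨C, q, hq, hq1, hbound⟩ :=
    exists_norm_taylorCoeff_evolve_le (isCompact_uIcc (a := 0) (b := t)) hR hf
  have hfin (x : ℝ) (hx : x ∈ Set.uIcc 0 t) :=
    tsum_enorm_sq_ne_top_iff.mpr (summable_norm_sq_of_norm_le hq hq1 (hbound x hx))
  have heq := (solvesShellSystem_taylorCoeff_evolve (hf.mono (ball_subset_ball hR.le))
    _).tsum_norm_sq_eq (convex_uIcc 0 t) hq hq1 hbound Set.left_mem_uIcc Set.right_mem_uIcc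
  simp only [← toReal_tsum_enorm_sq] at heq
  simpa only [hardyEnergy, evolve_zero] using (ENNReal.toReal_eq_toReal_iff'
    (hfin t Set.right_mem_uIcc) (hfin 0 Set.left_mem_uIcc)).mp heq

theorem hardyEnergy_comp_mul_le (hf : AnalyticAt ℂ f 0) (hr : r ∈ Set.Icc 0 1) :
    hardyEnergy (fun z => f (r * z)) ≤ hardyEnergy f := by
  refine ENNReal.tsum_le_tsum fun n => ?_
  rw [taylorCoeff_comp_const_mul _ hf, enorm_mul, enorm_pow]
  gcongr
  refine mul_le_of_le_one_left' (pow_le_one' ?_ n)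
  rw [← ofReal_norm, Complex.norm_of_nonneg hr.1]
  exact ENNReal.ofReal_le_one.mpr hr.2

theorem hardyEnergy_evolve_comp_mul (hf : DifferentiableOn ℂ f (ball 0 1)) (hr : r ∈ Set.Ico 0 1)
    (t : ℝ) : hardyEnergy (evolve (fun z => f (r * z)) t) = hardyEnergy fun z => f (r * z) := by
  have h0 := hr.1
  have hr1 := hr.2
  refine hardyEnergy_evolve_of_one_lt (R := 2 / (1 + r)) ?_ (hf.comp (by fun_prop) fun z hz => ?_) t
  · rw [lt_div_iff₀ (by positivity)]
    linarith
  · rw [mem_ball_zero_iff, lt_div_iff₀ (by positivity)] at hz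
    rw [mem_ball_zero_iff, norm_mul, Complex.norm_of_nonneg h0]
    nlinarith [norm_nonneg z]

theorem ofReal_mul_mem_ball (hr : r ∈ Set.Icc 0 1) {z : ℂ} (hz : z ∈ ball (0 : ℂ) R) :
    r * z ∈ ball (0 : ℂ) R := by
  rw [mem_ball_zero_iff] at hz ⊢
  rw [norm_mul, Complex.norm_of_nonneg hr.1]
  exact (mul_le_of_le_one_left (norm_nonneg z) hr.2).trans_lt hz

theorem continuousOn_evolve_comp_mul (hf : ContinuousOn f (ball 0 1)) (t : ℝ) :
    ContinuousOn (fun p : ℝ × ℂ => evolve (fun z => f (p.1 * z)) t p.2)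
      (Set.Icc 0 1 ×ˢ ball 0 1) := by
  have hden (p : ℝ × ℂ) (hp : p ∈ Set.Icc (0 : ℝ) 1 ×ˢ ball (0 : ℂ) 1) : flowDen t p.2 ≠ 0 :=
    flowDen_ne_zero t (mem_ball_zero_iff.mp hp.2).le
  have hflow : ContinuousOn (fun p : ℝ × ℂ => flow t p.2) (Set.Icc 0 1 ×ˢ ball 0 1) :=
    continuousOn_flow.comp (f := fun p : ℝ × ℂ => (t, p.2)) (by fun_prop) hden
  have hmul : ContinuousOn (fun p : ℝ × ℂ => (p.1 : ℂ) * flow t p.2) (Set.Icc 0 1 ×ˢ ball 0 1) :=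
    (by fun_prop : Continuous fun p : ℝ × ℂ => (p.1 : ℂ)).continuousOn.mul hflow
  have hmem : Set.MapsTo (fun p : ℝ × ℂ => (p.1 : ℂ) * flow t p.2) (Set.Icc 0 1 ×ˢ ball 0 1)
      (ball 0 1) := fun p hp => ofReal_mul_mem_ball hp.1 (mapsTo_flow_ball t hp.2)
  exact (hf.comp hmul hmem).div
    ((differentiable_flowDen t).continuous.comp continuous_snd).continuousOn hden

theorem tendsto_taylorCoeff_evolve_comp_mul {ι : Type*} {l : Filter ι} [l.IsCountablyGenerated]
    {r : ι → ℝ} (hf : DifferentiableOn ℂ f (ball 0 1)) (hr : ∀ i, r i ∈ Set.Icc 0 1)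
    (hlim : Tendsto r l (𝓝 1)) (t : ℝ) (n : ℕ) :
    Tendsto (fun i => taylorCoeff (evolve (fun z => f (r i * z)) t) n) l
      (𝓝 (taylorCoeff (evolve f t) n)) := by
  obtain ⟨ρ, hρ, hρ1⟩ := exists_between (zero_lt_one' ℝ)
  have hsub : closedBall (0 : ℂ) ρ ⊆ ball 0 1 := closedBall_subset_ball hρ1
  have hcont := (continuousOn_evolve_comp_mul hf.continuousOn t).mono
    (Set.prod_mono_right (sphere_subset_closedBall.trans hsub))
  obtain ⟨C, hC⟩ := (isCompact_Icc.prod (isCompact_sphere _ _)).exists_bound_of_continuousOn hcont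
  refine tendsto_taylorCoeff_of_bounded (C := C) hρ (fun i => ?_)
    ((differentiableOn_evolve_ball hf t).diffContOnCl_ball hsub)
    (.of_forall fun i z hz => hC (r i, z) ⟨hr i, hz⟩) (fun z hz => ?_) n
  · exact (differentiableOn_evolve_ball (hf.comp (by fun_prop) fun z hz =>
      ofReal_mul_mem_ball (hr i) hz) t).diffContOnCl_ball hsub
  · have hone := (hcont (1, z) ⟨⟨zero_le_one, le_rfl⟩, hz⟩).tendsto.comp
      (tendsto_nhdsWithin_iff.mpr ⟨hlim.prodMk_nhds tendsto_const_nhds,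
        .of_forall fun i => ⟨hr i, hz⟩⟩)
    simpa only [Function.comp_def, Complex.ofReal_one, one_mul] using hone

theorem hardyEnergy_evolve_le (hf : DifferentiableOn ℂ f (ball 0 1)) (t : ℝ) :
    hardyEnergy (evolve f t) ≤ hardyEnergy f := by
  obtain ⟨r, hr, hr1⟩ : ∃ r : ℕ → ℝ, (∀ k, r k ∈ Set.Ico 0 1) ∧ Tendsto r atTop (𝓝 1) :=
    ⟨fun k => k / (k + 1),
      fun k => ⟨by positivity, (div_lt_one (Nat.cast_add_one_pos k)).mpr (lt_add_one _)⟩,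
      tendsto_natCast_div_add_atTop 1⟩
  have hr' (k : ℕ) : r k ∈ Set.Icc 0 1 := Set.Ico_subset_Icc_self (hr k)
  have hlim (n : ℕ) : Tendsto (fun k => ‖taylorCoeff (evolve (fun z => f (r k * z)) t) n‖ₑ ^ 2)
      atTop (𝓝 (‖taylorCoeff (evolve f t) n‖ₑ ^ 2)) :=
    ENNReal.Tendsto.pow (tendsto_taylorCoeff_evolve_comp_mul hf hr' hr1 t n).enorm
  refine ENNReal.tsum_le_of_sum_range_le fun N =>
    le_of_tendsto' (tendsto_finsetSum (Finset.range N) fun n _ => hlim n) fun k => ?_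
  calc ∑ n ∈ Finset.range N, ‖taylorCoeff (evolve (fun z => f (r k * z)) t) n‖ₑ ^ 2
      ≤ hardyEnergy (evolve (fun z => f (r k * z)) t) := ENNReal.sum_le_tsum _
    _ = hardyEnergy fun z => f (r k * z) := hardyEnergy_evolve_comp_mul hf (hr k) t
    _ ≤ hardyEnergy f :=
        hardyEnergy_comp_mul_le (analyticAt_zero_of_differentiableOn_ball one_pos hf) (hr' k)

theorem hardyEnergy_evolve (hf : DifferentiableOn ℂ f (ball 0 1)) (t : ℝ) :
    hardyEnergy (evolve f t) = hardyEnergy f := by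
  refine (hardyEnergy_evolve_le hf t).antisymm ?_
  have hinv : evolve (evolve f t) (-t) =ᶠ[𝓝 0] f := by
    filter_upwards [ball_mem_nhds (0 : ℂ) one_pos] with z hz
    rw [evolve_evolve f (flowDen_ne_zero (-t) (mem_ball_zero_iff.mp hz).le), add_neg_cancel,
      evolve_zero]
  calc hardyEnergy f = hardyEnergy (evolve (evolve f t) (-t)) :=
        tsum_congr fun n => by rw [taylorCoeff_congr hinv]
    _ ≤ hardyEnergy (evolve f t) := hardyEnergy_evolve_le (differentiableOn_evolve_ball hf t) (-t)

end HardyEnergy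

theorem IsSolution.tsum_enorm_sq_eq {a₀ : ℕ → ℝ} {a : ℕ → ℝ → ℝ} {f : ℂ → ℂ} {t : ℝ}
    (ha : IsSolution a₀ a) (hf : IsGenerating a₀ f) (ht : 0 ≤ t) :
    ∑' n, ‖a n t‖ₑ ^ 2 = ∑' n, ‖a n 0‖ₑ ^ 2 := by
  have henergy (x : ℝ) (hx : 0 ≤ x) : ∑' n, ‖a n x‖ₑ ^ 2 = hardyEnergy (evolve f x) := by
    rw [tsum_eq_zero_add' ENNReal.summable, ha.boundary x hx, hardyEnergy]
    simp [ha.taylorCoeff_evolve_eq hf hx, ← ofReal_norm]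
  rw [henergy t ht, henergy 0 le_rfl, evolve_zero, hardyEnergy_evolve hf.differentiableOn]

end Energy

section EnergyRate

variable {a₀ u : ℕ → ℝ} {a : ℕ → ℝ → ℝ} {A α t : ℝ}

theorem HasAlternatingPowerLaw.summable_sq_iff (hA : A ≠ 0) (hα : 0 < α)
    (h : HasAlternatingPowerLaw u A α) : (Summable fun n => |u n| ^ 2) ↔ α < 1 / 2 := by
  have hsq : (fun n => |u n| ^ 2) ~[atTop] fun n : ℕ =>
      (A / Real.Gamma α) ^ 2 * (n : ℝ) ^ ((α - 1) * 2) := by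
    refine ((h.pow 2).congr_left (.of_forall fun n => (sq_abs (u n)).symm)).congr_right
      (.of_forall fun n => ?_)
    simp only [Pi.pow_apply]
    rw [mul_pow, mul_pow, neg_sq, ← pow_mul, (even_two.mul_left n).neg_one_pow,
      mul_one, Real.rpow_mul n.cast_nonneg, Real.rpow_two]
  rw [hsq.summable_iff_nat, summable_mul_left_iff (by positivity), Real.summable_nat_rpow]
  constructor <;> intro _ <;> linarith

theorem HasAlternatingPowerLaw.isEquivalent_energyRate (h : HasAlternatingPowerLaw u A α) :
    (fun N : ℕ => -(2 * N * (u N * u (N + 1)))) ~[atTop] fun N : ℕ =>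
      2 * (A / Real.Gamma α) ^ 2 * (N : ℝ) ^ (2 * α - 1) := by
  refine ((IsEquivalent.refl (u := fun N : ℕ => 2 * (N : ℝ))).mul
    (h.mul (hasAlternatingPowerLaw_iff_succ.mp h))).neg.congr_right ?_
  filter_upwards [eventually_gt_atTop 0] with N hN
  have hpow : (N : ℝ) ^ (2 * α - 1) = N * ((N : ℝ) ^ (α - 1)) ^ 2 := by
    have hN' : (0 : ℝ) < N := Nat.cast_pos.mpr hN
    rw [← Real.rpow_two, ← Real.rpow_mul hN'.le, mul_comm (N : ℝ), ← Real.rpow_add_one hN'.ne']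
    ring_nf
  have hsign : (-1 : ℝ) ^ N * (-1) ^ N = 1 := by simp [← mul_pow]
  simp only [Pi.mul_apply, hpow]
  linear_combination (2 * N * (A / Real.Gamma α) ^ 2 * ((N : ℝ) ^ (α - 1)) ^ 2) * hsign

theorem IsSolution.hasDerivWithinAt_blockEnergy (ha : IsSolution a₀ a) (ht : 0 ≤ t) (N : ℕ) :
    HasDerivWithinAt (blockEnergy a 0 N) (-(2 * N * (a N t * a (N + 1) t))) (Set.Ici 0) t := by
  have hblock (x : ℝ) (hx : x ∈ Set.Ici 0) :
      blockEnergy a 0 N x = ∑ n ∈ Finset.range N, ‖a (n + 1) x‖ ^ 2 := by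
    rw [blockEnergy, ← Nat.range_succ_eq_Icc_zero, Finset.sum_range_succ', ha.boundary x hx]
    simp
  refine ((ha.solvesShellSystem.hasDerivWithinAt_energy ht N).congr hblock
    (hblock t ht)).congr_deriv ?_
  cases N with
  | zero => simp
  | succ N =>
    simp only [Nat.add_sub_cancel, Real.inner_apply]
    ring

theorem IsSolution.energyRateTendsto_nhds_zero (ha : IsSolution a₀ a) (ht : 0 ≤ t)
    (h : HasAlternatingPowerLaw (fun n => a n t) A α) (hα : α < 1 / 2) :
    EnergyRateTendsto a t (𝓝 0) := by
  refine ⟨_, ha.hasDerivWithinAt_blockEnergy ht, h.isEquivalent_energyRate.symm.tendsto_nhds ?_⟩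
  have hdecay := (tendsto_rpow_neg_atTop (y := 1 - 2 * α) (by linarith)).comp
    tendsto_natCast_atTop_atTop
  simpa [Function.comp_def] using hdecay.const_mul (2 * (A / Real.Gamma α) ^ 2)

theorem IsSolution.energyRateTendsto_nhds (ha : IsSolution a₀ a) (ht : 0 ≤ t)
    (h : HasAlternatingPowerLaw (fun n => a n t) A (1 / 2)) :
    EnergyRateTendsto a t (𝓝 (2 * (A / Real.Gamma (1 / 2)) ^ 2)) :=
  ⟨_, ha.hasDerivWithinAt_blockEnergy ht, h.isEquivalent_energyRate.symm.tendsto_nhds (by simp)⟩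

theorem IsSolution.energyRateTendsto_atTop (ha : IsSolution a₀ a) (ht : 0 ≤ t) (hA : A ≠ 0)
    (h : HasAlternatingPowerLaw (fun n => a n t) A α) (hα : 1 / 2 < α) :
    EnergyRateTendsto a t atTop := by
  refine ⟨_, ha.hasDerivWithinAt_blockEnergy ht, h.isEquivalent_energyRate.symm.tendsto_atTop ?_⟩
  have := one_half_pos.trans hα
  exact ((tendsto_rpow_atTop (by linarith)).comp tendsto_natCast_atTop_atTop).const_mul_atTop
    (by positivity)

theorem IsSolution.isConservative {f : ℂ → ℂ} (ha : IsSolution a₀ a) (hf : IsGenerating a₀ f)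
    (h₀ : Summable fun n => |a₀ n| ^ 2) : IsConservative a := by
  have hfin₀ : FiniteEnergy a 0 := by
    rw [FiniteEnergy, ← summable_nat_add_iff 1]
    simpa only [ha.initial] using (summable_nat_add_iff 1).mpr h₀
  simp only [FiniteEnergy, ← Real.norm_eq_abs] at hfin₀
  refine .inl fun t ht => ?_
  have henergy := ha.tsum_enorm_sq_eq hf ht
  simp only [FiniteEnergy, ← Real.norm_eq_abs, ← toReal_tsum_enorm_sq, henergy, and_true]
  exact tsum_enorm_sq_ne_top_iff.mp (henergy.trans_ne (tsum_enorm_sq_ne_top_iff.mpr hfin₀))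

end EnergyRate

end ShellModel

theorem mainTheorem5 (a₀ : ℕ → ℝ) (A α : ℝ) (hA : A ≠ 0) (hα : 0 < α) :
    (ShellModel.HasAlternatingPowerLaw a₀ A α ∨ ShellModel.HasDeltaSingularity a₀ A α →
      (∃ a : ℕ → ℝ → ℝ, ShellModel.IsSolution a₀ a) ∧
      ∀ a : ℕ → ℝ → ℝ, ShellModel.IsSolution a₀ a →
        (∀ m : ℕ,
          Tendsto (fun t : ℝ => a (m + 1) t / Real.exp ((2 * α - 1) * t)) atTop
            (𝓝 ((2 : ℝ) ^ (1 - α) * A * ShellModel.taylorC α m)) ∧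
          (ShellModel.taylorC α m ≠ 0 →
            (fun t : ℝ => a (m + 1) t) ~[atTop] fun t : ℝ =>
              (2 : ℝ) ^ (1 - α) * Real.exp ((2 * α - 1) * t) * A * ShellModel.taylorC α m)) ∧
        (α < 1 / 2 → ShellModel.IsConservative a)) ∧
    (ShellModel.HasDeltaSingularity a₀ A α →
      ∀ a : ℕ → ℝ → ℝ, ShellModel.IsSolution a₀ a →
        (∀ t : ℝ, 0 ≤ t →
          (fun n : ℕ => a n t) ~[atTop] fun n : ℕ =>
            A / Real.Gamma α * Real.exp ((2 * α - 1) * t) * (-1) ^ (n + 1) *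
              (n : ℝ) ^ (α - 1)) ∧
        (α < 1 / 2 → ∀ t : ℝ, 0 ≤ t → ShellModel.EnergyRateTendsto a t (𝓝 0)) ∧
        (α = 1 / 2 → ShellModel.HasFiniteExplosionRate a) ∧
        (1 / 2 < α → ShellModel.HasInfiniteExplosionRate a)) := by
  refine ⟨fun hCD => ?_, fun hD a ha => ?_⟩
  · have hC := hCD.elim id fun hD => hD.hasAlternatingPowerLaw hA hα
    obtain ⟨f, hf⟩ := hC.exists_isGenerating hα
    refine ⟨hf.exists_isSolution, fun a ha => ⟨fun m => ?_, fun hα' =>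
      ha.isConservative hf ((hC.summable_sq_iff hA hα).mpr hα')⟩⟩
    have hlim := ha.tendsto_div_exp hα hC m
    refine ⟨hlim, fun hne => ?_⟩
    exact (ShellModel.isEquivalent_const_mul_of_tendsto_div (by positivity)
      (.of_forall fun t => (Real.exp_pos _).ne') hlim).congr_right (.of_forall fun t => by ring)
  · have hamp (t : ℝ) : A * Real.exp ((2 * α - 1) * t) ≠ 0 := mul_ne_zero hA (Real.exp_pos _).ne'
    have hlaw (t : ℝ) (ht : 0 ≤ t) := ha.hasAlternatingPowerLaw hA hα hD ht
    have hinfinite (hα' : 1 / 2 ≤ α) (t : ℝ) (ht : 0 ≤ t) : ¬ShellModel.FiniteEnergy a t :=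
      mt ((hlaw t ht).summable_sq_iff (hamp t) hα).mp hα'.not_gt
    refine ⟨fun t ht => (hlaw t ht).congr_right (.of_forall fun n => by ring),
      fun hα' t ht => ha.energyRateTendsto_nhds_zero ht (hlaw t ht) hα',
      fun hα' t ht => ⟨hinfinite hα'.ge t ht, ?_⟩,
      fun hα' t ht => ⟨hinfinite hα'.le t ht,
        ha.energyRateTendsto_atTop ht (hamp t) (hlaw t ht) hα'⟩⟩
    subst hα'
    exact ⟨_, by positivity, ha.energyRateTendsto_nhds ht (hlaw t ht)⟩
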